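/- **Ergodic capacity of the FRIS channel.** Let $M_{\rm on}\ge 1$ and let $\mathbf R$ be a Hermitian positive semidefinite complex $M_{\rm on}\times M_{\rm on}$ matrix (the spatial correlation matrix of the active elements). Let $\boldsymbol\Phi=\mathrm{diag}(e^{\mathrm i\theta_1},\dots,e^{\mathrm i\theta_{M_{\rm on}}})$ with fixed real phases, and put $$\mathbf A=\mathbf R^{1/2}\boldsymbol\Phi\mathbf R^{1/2},\qquad \mathbf C=\mathbf A\mathbf A^{\mathsf H},\qquad G_0=|\mathbf g_{\rm u}^{\mathsf H}\mathbf A\,\mathbf g_{\rm f}|^2,$$ where $\mathbf g_{\rm f},\mathbf g_{\rm u}$ are independent random vectors with law $\mathcal{CN}(\mathbf 0,\mathbf I_{M_{\rm on}})$. Let $P,N_0,\rho_{\rm f},d_{\rm f},\rho_{\rm u},d_{\rm u}>0$, let $\alpha_{\rm f},\alpha_{\rm u}$ be real, and put $\bar\gamma=P/N_0$, $L_{\rm f}=\rho_{\rm f}d_{\rm f}^{-\alpha_{\rm f}}$, $L_{\rm u}=\rho_{\rm u}d_{\rm u}^{-\alpha_{\rm u}}$. The ergodic capacity is $\bar C=\mathbb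 E[\log_2(1+\bar\gamma L_{\rm f}L_{\rm u}G_0)]$. Let $\lambda_1,\dots,\lambda_q$ be the distinct strictly positive eigenvalues of $\mathbf C$, with multiplicities $m_1,\dots,m_q$, and for $1\le i\le q$, $1\le k\le m_i$ let $$c_{i,k}=\frac1{(m_i-k)!}\,\frac{d^{\,m_i-k}}{du^{\,m_i-k}}H_i(u)\Big|_{u=0},\qquad H_i(u)=\prod_{j\ne i}\Big(\frac{\lambda_j}{\lambda_i}u+1-\frac{\lambda_j}{\lambda_i}\Big)^{-m_j}.$$ The Meijer $G$-function is defined by $$G^{m,n}_{p,q}\Big(z\,\Big|\,{a_1,\dots,a_p\atop b_1,\dots,b_q}\Big)=\frac1{2\pi\mathrm i}\int_{\mathcal L}\frac{\prod_{j\le m}\Gamma(b_j-s)\prod_{j\le n}\Gamma(1-a_j+s)}{\prod_{j>m}\Gamma(1-b_j+s)\prod_{j>n}\Gamma(a_j-s)}\,z^s\,ds,$$ where $\mathcal L$ is an upward vertical line with the poles of the $\Gamma(b_j-s)$, $j\le m$, on its right and those of the $\Gamma(1-a_j+s)$, $j\le n$, on its left. For the parameters below such lines exist and, for $z>0$, the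 integral converges absolutely along each of them, with the same value. Then the expectation $\bar C$ is finite and $$\bar C=\frac1{\ln 2}\sum_{i=1}^q\sum_{k=1}^{m_i}\frac{c_{i,k}}{\Gamma(k)}\,G^{1,4}_{4,2}\Big(\bar\gamma L_{\rm f}L_{\rm u}\lambda_i\,\Big|\,{1-k,\,0,\,1,\,1\atop 1,\,0}\Big).$$ In particular: * (simple eigenvalues) if $m_i=1$ for all $i$, then $\bar C=\frac1{\ln2}\sum_{i=1}^q c_{i,1}\,G^{1,4}_{4,2}\big(\bar\gamma L_{\rm f}L_{\rm u}\lambda_i\,\big|\,{0,0,1,1\atop 1,0}\big)$ with $c_{i,1}=\prod_{j\ne i}\frac{\lambda_i}{\lambda_i-\lambda_j}$; * (equal eigenvalues) if $q=1$, then $\bar C=\frac1{\ln(2)\,\Gamma(m_1)}\,G^{1,4}_{4,2}\big(\bar\gamma L_{\rm f}L_{\rm u}\lambda_1\,\big|\,{1-m_1,0,1,1\atop 1,0}\big)$; * (uncorrelated elements) if $\mathbf R=\mathbf I_{M_{\rm on}}$, then $\bar C=\frac1{\ln(2)\,\Gamma(M_{\rm on})}\,G^{1,4}_{4,2}\big(\bar\gamma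 L_{\rm f}L_{\rm u}\,\big|\,{1-M_{\rm on},0,1,1\atop 1,0}\big)$. All this applies to the Clarke–Jakes model: for elements of a planar array at the positions $\mathbf p_{i,j}=[i\,d_w\lambda_c,\;j\,d_w\lambda_c]^{\mathsf T}$, $0\le i<M_x$, $0\le j<M_z$ ($d_w,\lambda_c>0$), and any set $\mathcal S$ of active elements, the matrix $\mathbf R_{\mathcal S}=\big[J_0\big(\tfrac{2\pi}{\lambda_c}\|\mathbf p-\mathbf p'\|_2\big)\big]_{\mathbf p,\mathbf p'\in\mathcal S}$, where $J_0$ is the Bessel function of the first kind of order zero, is Hermitian and positive semidefinite. -/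

import Mathlib

open MeasureTheory ProbabilityTheory Matrix
open scoped ComplexOrder MatrixOrder

noncomputable section

/-! ### The Meijer G-function -/

/-- The Mellin-Barnes integrand of `G^{m,n}_{p,q}(z | a; b)`:
`∏_{j ≤ m} Γ(b_j - s) ∏_{j ≤ n} Γ(1 - a_j + s) /
  (∏_{j > m} Γ(1 - b_j + s) ∏_{j > n} Γ(a_j - s)) * z ^ s`.
(`Complex.Gamma` is `0` at its poles, so that `1 / Γ` correctly vanishes there.) -/
def meijerGIntegrand (m n : ℕ) {p q : ℕ} (a : Fin p → ℂ) (b : Fin q → ℂ) (z s : ℂ) : ℂ :=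
  ((∏ j : Fin q, if (j : ℕ) < m then Complex.Gamma (b j - s) else 1) *
    (∏ j : Fin p, if (j : ℕ) < n then Complex.Gamma (1 - a j + s) else 1)) /
  ((∏ j : Fin q, if (j : ℕ) < m then 1 else Complex.Gamma (1 - b j + s)) *
    (∏ j : Fin p, if (j : ℕ) < n then 1 else Complex.Gamma (a j - s))) * z ^ s

/-- The vertical line `Re s = c` has the poles `b_j + l` of `Γ(b_j - s)`, `j ≤ m`, on its right
and the poles `a_j - 1 - l` of `Γ(1 - a_j + s)`, `j ≤ n`, on its left. -/
def MeijerGSeparates (m n : ℕ) {p q : ℕ} (a : Fin p → ℂ) (b : Fin q → ℂ) (c : ℝ) : Prop :=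
  (∀ j : Fin q, (j : ℕ) < m → ∀ l : ℕ, c < (b j + l).re) ∧
  (∀ j : Fin p, (j : ℕ) < n → ∀ l : ℕ, (a j - 1 - l).re < c)

/-- `(1 / (2 π i)) ∫` of the Mellin-Barnes integrand along `Re s = c`, upwards. -/
def meijerGLineIntegral (m n : ℕ) {p q : ℕ} (a : Fin p → ℂ) (b : Fin q → ℂ) (z : ℂ) (c : ℝ) : ℂ :=
  (1 / (2 * Real.pi) : ℂ) * ∫ t : ℝ, meijerGIntegrand m n a b z (c + t * Complex.I)

open Classical in
/-- The Meijer G-function `G^{m,n}_{p,q}(z | a; b)` for parameters whose two families of poles are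
separated by a vertical line: the Mellin-Barnes integral along such a line (`0` if there is no
such line). -/
def meijerG (m n : ℕ) {p q : ℕ} (a : Fin p → ℂ) (b : Fin q → ℂ) (z : ℂ) : ℂ :=
  if h : ∃ c : ℝ, MeijerGSeparates m n a b c then meijerGLineIntegral m n a b z h.choose else 0

/-- `G^{m,n}_{p,q}(z | a; b)` is given by a Mellin-Barnes integral in the proper sense: a separating
vertical line exists, and along each such line the integral converges absolutely, with the same
value `meijerG m n a b z`. -/
def MeijerGWellDefined (m n : ℕ) {p q : ℕ} (a : Fin p → ℂ) (b : Fin q → ℂ) (z : ℂ) : Prop :=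
  (∃ c : ℝ, MeijerGSeparates m n a b c) ∧
  ∀ c : ℝ, MeijerGSeparates m n a b c →
    Integrable (fun t : ℝ => meijerGIntegrand m n a b z (c + t * Complex.I)) ∧
    meijerG m n a b z = meijerGLineIntegral m n a b z c

/-! ### The channel model -/

/-- The law `CN(0, 1)` on `ℂ`: independent real and imaginary parts, each `N(0, 1/2)`. -/
def stdComplexGaussian : Measure ℂ :=
  ((gaussianReal 0 (1 / 2)).prod (gaussianReal 0 (1 / 2))).map
    (fun x : ℝ × ℝ => (x.1 : ℂ) + (x.2 : ℂ) * Complex.I)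

/-- The law `CN(0, I)` on `ℂ^ι`: independent `CN(0, 1)` coordinates. -/
def stdComplexGaussianVec (ι : Type*) [Fintype ι] : Measure (ι → ℂ) :=
  Measure.pi (fun _ : ι => stdComplexGaussian)

/-- The Bessel function `J₀` of the first kind, by Bessel's integral. -/
def besselJZero (x : ℝ) : ℝ :=
  (1 / Real.pi) * ∫ φ in (0 : ℝ)..Real.pi, Real.cos (x * Real.sin φ)

/-- The location `[i d_w λ_c, j d_w λ_c]` of the element `(i, j)` of an `Mx × Mz` planar array. -/
def elementPosition {Mx Mz : ℕ} (dw lc : ℝ) (e : Fin Mx × Fin Mz) : EuclideanSpace ℝ (Fin 2) :=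
  !₂[(e.1 : ℕ) * dw * lc, (e.2 : ℕ) * dw * lc]

/-- The Clarke-Jakes correlation matrix of the active set `S`, with entries
`J₀((2 π / λ_c) ‖p_e - p_e'‖)`. -/
def jakesCorrelation {Mx Mz : ℕ} (dw lc : ℝ) (S : Finset (Fin Mx × Fin Mz)) : Matrix S S ℂ :=
  fun e e' => ((besselJZero (2 * Real.pi / lc *
    ‖elementPosition dw lc e.1 - elementPosition dw lc e'.1‖) : ℝ) : ℂ)

variable {ι : Type*} [Fintype ι] [DecidableEq ι]

/-- The reflection matrix `Φ = diag(e^{i θ_1}, e^{i θ_2}, …)`. -/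
def reflectionMatrix (θ : ι → ℝ) : Matrix ι ι ℂ :=
  Matrix.diagonal (fun l => Complex.exp (Complex.I * (θ l : ℂ)))

/-- The coupling matrix `A = R^{1/2} Φ R^{1/2}`, with the positive semidefinite square root. -/
def couplingMatrix (R : Matrix ι ι ℂ) (θ : ι → ℝ) : Matrix ι ι ℂ :=
  CFC.sqrt R * reflectionMatrix θ * CFC.sqrt R

/-- The composite matrix `C = A Aᴴ`. -/
def compositeMatrix (R : Matrix ι ι ℂ) (θ : ι → ℝ) : Matrix ι ι ℂ :=
  couplingMatrix R θ * (couplingMatrix R θ)ᴴ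

/-- The end-to-end channel gain `G₀ = |g_uᴴ A g_f|²`. -/
def channelGain (R : Matrix ι ι ℂ) (θ : ι → ℝ) (gu gf : ι → ℂ) : ℝ :=
  ‖star gu ⬝ᵥ (couplingMatrix R θ *ᵥ gf)‖ ^ 2

/-- The large-scale attenuation `L = ρ d^{-α}`. -/
def pathLoss (ρ d α : ℝ) : ℝ := ρ * d ^ (-α)

/-- The instantaneous capacity `log₂(1 + γ)`, where the SNR is `γ = γ̄ L_f L_u G₀`. -/
def instantCapacity (R : Matrix ι ι ℂ) (θ : ι → ℝ) (gbar Lf Lu : ℝ) (gu gf : ι → ℂ) : ℝ :=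
  Real.logb 2 (1 + gbar * Lf * Lu * channelGain R θ gu gf)

/-- The ergodic capacity `E[log₂(1 + γ)]`. -/
def ergodicCapacity {Ω : Type*} [MeasurableSpace Ω] (P : Measure Ω) (R : Matrix ι ι ℂ)
    (θ : ι → ℝ) (gbar Lf Lu : ℝ) (gu gf : Ω → ι → ℂ) : ℝ :=
  ∫ ω, instantCapacity R θ gbar Lf Lu (gu ω) (gf ω) ∂P

/-! ### Spectrum and mixture coefficients -/

/-- `lam` enumerates, without repetition, the strictly positive eigenvalues of `C`, and `m` their
multiplicities (dimensions of the eigenspaces). -/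
structure IsPositiveSpectrum (C : Matrix ι ι ℂ) {q : ℕ} (lam : Fin q → ℝ) (m : Fin q → ℕ) :
    Prop where
  injective : Function.Injective lam
  eigenvalue_iff : ∀ μ : ℝ,
    (0 < μ ∧ Module.End.HasEigenvalue (Matrix.toLin' C) (μ : ℂ)) ↔ ∃ i, lam i = μ
  multiplicity : ∀ i,
    m i = Module.finrank ℂ (Module.End.eigenspace (Matrix.toLin' C) (lam i : ℂ))

/-- `H_i(u) = ∏_{j ≠ i} ((λ_j / λ_i) u + 1 - λ_j / λ_i)^{-m_j}`. -/
def mixtureH {q : ℕ} (lam : Fin q → ℝ) (m : Fin q → ℕ) (i : Fin q) (u : ℝ) : ℝ :=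
  ∏ j ∈ Finset.univ.erase i, ((lam j / lam i * u + 1 - lam j / lam i) ^ m j)⁻¹

/-- `c_{i,k} = H_i^{(m_i - k)}(0) / (m_i - k)!`, used for `1 ≤ k ≤ m_i`. -/
def mixtureCoeff {q : ℕ} (lam : Fin q → ℝ) (m : Fin q → ℕ) (i : Fin q) (k : ℕ) : ℝ :=
  (1 / ((m i - k).factorial : ℝ)) * iteratedDeriv (m i - k) (mixtureH lam m i) 0

end

/-! Given `gu = u`, the scalar uᴴ A g_f is complex Gaussian of variance Q(u) = uᴴ C u, so G₀ has the
law of Q · E with E a standard exponential variable independent of Q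
(`integral_exp_neg_mul_channelGain`). Diagonalising C and using the unitary invariance of CN(0, I),
Q has Laplace transform ∏ (1 + λ_j t)^(-m_j) (`integral_exp_neg_mul_hermitian`,
`IsPositiveSpectrum.prod_eigenvalues`). Partial fractions turn this into ∑ c_{i,k} (1 + λ_i t)^(-k),
the transform of a signed mixture of the laws of λ_i X_k with X_k ~ Gamma(k)
(`sum_mixtureCoeff_mul_inv_pow`).

Densities and uniqueness of Laplace transforms are not needed. Frullani's formula log(1 + x) = ∫
e^(-y) (1 - e^(-xy)) dy / y expresses E log(1 + X) linearly through 1 - E e^(-yX), so the mixture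
identity passes directly to logarithmic expectations (`integral_log_one_add_eq_sum`).

It remains to evaluate E log(1 + x X_k E). Mellin inversion gives log(1 + a) = (1/2πi) ∫ Γ(s) Γ(1-s)
a^s ds / s on 0 < Re s < 1; integrating against the moments E X_k^s = Γ(k+s)/Γ(k) and E E^s = Γ(1+s)
produces the Meijer integrand divided by Γ(k) (`mellinBarnes_capacity`). The result does not mention
the line, which also gives independence of the contour.

The Clarke-Jakes matrix is an angular average of plane-wave Gram matrices, hence positive
semidefinite. -/

/-! ### The Clarke-Jakes correlation matrix -/

/-- In polar coordinates for v the integrand on the right is a translate of cos(r‖v‖ sin φ). That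
function has period π, so [0, 2π] covers two periods and the translation is harmless. -/
lemma besselJZero_mul_norm (r : ℝ) (v : EuclideanSpace ℝ (Fin 2)) :
    besselJZero (r * ‖v‖) = (1 / (2 * Real.pi)) *
      ∫ φ in (0 : ℝ)..(2 * Real.pi), Real.cos (r * (v 0 * Real.cos φ + v 1 * Real.sin φ)) := by
  set z : ℂ := ⟨v 0, v 1⟩ with hz
  have hnorm : ‖v‖ = ‖z‖ := by
    rw [EuclideanSpace.norm_eq, Complex.norm_def, Complex.normSq_apply]
    simp [Fin.sum_univ_two, hz, sq]
  set g : ℝ → ℝ := fun φ => Real.cos (r * ‖v‖ * Real.sin φ) with hg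
  have hper : Function.Periodic g Real.pi := fun φ => by
    simp [hg, Real.sin_add_pi]
  have h0 : v 0 = ‖v‖ * Real.cos z.arg := by rw [hnorm, Complex.norm_mul_cos_arg]
  have h1 : v 1 = ‖v‖ * Real.sin z.arg := by rw [hnorm, Complex.norm_mul_sin_arg]
  have hshift : ∀ φ : ℝ, Real.cos (r * (v 0 * Real.cos φ + v 1 * Real.sin φ)) =
      g (φ + (Real.pi / 2 - z.arg)) := fun φ => by
    have : φ + (Real.pi / 2 - z.arg) = (φ - z.arg) + Real.pi / 2 := by ring
    rw [hg]
    simp only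
    rw [this, Real.sin_add_pi_div_two, Real.cos_sub, h0, h1]
    ring_nf
  simp_rw [hshift]
  rw [intervalIntegral.integral_comp_add_right g, zero_add,
    show 2 * Real.pi + (Real.pi / 2 - z.arg) = (Real.pi / 2 - z.arg) + (2 : ℤ) • Real.pi by
      simp; ring, hper.intervalIntegral_add_zsmul_eq _ _
        (fun a b => Continuous.intervalIntegrable (by fun_prop) a b),
    hper.intervalIntegral_add_eq _ 0, zero_add, besselJZero, zsmul_eq_mul]
  push_cast
  field_simp
  rfl

/-- The phase in J₀ is linear in the position difference, so cos(a - b) = cos a cos b + sin a sin b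
makes the quadratic form an integral over φ of two squared moduli. -/
lemma jakesCorrelation_posSemidef {Mx Mz : ℕ} (dw lc : ℝ) (S : Finset (Fin Mx × Fin Mz)) :
    (jakesCorrelation dw lc S).PosSemidef := by
  set a : S → ℝ → ℝ := fun e φ => 2 * Real.pi / lc *
    (elementPosition dw lc e.1 0 * Real.cos φ + elementPosition dw lc e.1 1 * Real.sin φ) with ha
  have hac : ∀ e, Continuous (a e) := fun e => by fun_prop
  have hentry : ∀ e e', jakesCorrelation dw lc S e e' = (1 / (2 * Real.pi) : ℝ) *
      ∫ φ in (0 : ℝ)..(2 * Real.pi), ((Real.cos (a e φ) * Real.cos (a e' φ) +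
        Real.sin (a e φ) * Real.sin (a e' φ) : ℝ) : ℂ) := fun e e' => by
    rw [jakesCorrelation, besselJZero_mul_norm, intervalIntegral.integral_ofReal,
      Complex.ofReal_mul]
    congr! 4 with φ
    rw [← Real.cos_sub, ha]
    simp only [PiLp.sub_apply]
    ring_nf
  refine Matrix.PosSemidef.of_dotProduct_mulVec_nonneg ?_ fun x => ?_
  · ext e e'
    rw [Matrix.conjTranspose_apply, hentry, jakesCorrelation, ← jakesCorrelation, hentry,
      intervalIntegral.integral_ofReal, intervalIntegral.integral_ofReal, ← Complex.ofReal_mul,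
      ← Complex.ofReal_mul, Complex.star_def, Complex.conj_ofReal]
    simp_rw [mul_comm]
  · have hsum : star x ⬝ᵥ (jakesCorrelation dw lc S *ᵥ x) = ((1 / (2 * Real.pi) *
        ∫ φ in (0 : ℝ)..(2 * Real.pi), (‖∑ e, x e * (Real.cos (a e φ) : ℂ)‖ ^ 2 +
          ‖∑ e, x e * (Real.sin (a e φ) : ℂ)‖ ^ 2) : ℝ) : ℂ) := by
      have hpt : ∀ φ : ℝ, ((‖∑ e, x e * (Real.cos (a e φ) : ℂ)‖ ^ 2 +
          ‖∑ e, x e * (Real.sin (a e φ) : ℂ)‖ ^ 2 : ℝ) : ℂ) =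
          ∑ e, ∑ e', star (x e) * x e' * ((Real.cos (a e φ) * Real.cos (a e' φ) +
            Real.sin (a e φ) * Real.sin (a e' φ) : ℝ) : ℂ) := fun φ => by
        push_cast
        rw [← Complex.conj_mul', ← Complex.conj_mul', map_sum, map_sum, Finset.sum_mul_sum,
          Finset.sum_mul_sum, ← Finset.sum_add_distrib]
        refine Finset.sum_congr rfl fun e _ => ?_
        rw [← Finset.sum_add_distrib]
        refine Finset.sum_congr rfl fun e' _ => ?_
        simp only [map_mul, ← Complex.ofReal_cos, ← Complex.ofReal_sin, Complex.conj_ofReal,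
          Complex.star_def]
        ring
      rw [Complex.ofReal_mul, ← intervalIntegral.integral_ofReal]
      simp_rw [hpt]
      rw [intervalIntegral.integral_finsetSum
        fun e _ => Continuous.intervalIntegrable (by fun_prop) _ _, dotProduct, Finset.mul_sum]
      refine Finset.sum_congr rfl fun e _ => ?_
      rw [intervalIntegral.integral_finsetSum
        fun e _ => Continuous.intervalIntegrable (by fun_prop) _ _, mulVec, dotProduct,
        Finset.mul_sum, Finset.mul_sum]
      refine Finset.sum_congr rfl fun e' _ => ?_
      rw [intervalIntegral.integral_const_mul, hentry, Pi.star_apply]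
      ring
    rw [hsum]
    refine Complex.zero_le_real.2 (mul_nonneg (by positivity) ?_)
    exact intervalIntegral.integral_nonneg (by positivity) fun φ _ => by positivity

/-! ### Partial fractions -/

open Polynomial in
-- Division by pairwise coprime powers leaves a quotient and remainders of degree below 1, i.e.
-- constants. The quotient vanishes by degree, which needs a nonconstant product: hence `hdeg`.
lemma Polynomial.exists_partialFraction_X_add_C {q : ℕ} (a : Fin q → ℝ) (m : Fin q → ℕ)
    (hinj : Function.Injective a) (hdeg : ∃ i, 0 < m i) :
    ∃ d : Fin q → ℕ → ℝ, (1 : ℝ[X]) = ∑ i, ∑ j ∈ Finset.range (m i),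
      C (d i j) * (X + C (a i)) ^ j * ∏ k ∈ Finset.univ.erase i, (X + C (a k)) ^ m k := by
  obtain ⟨Q, r, hr, hf⟩ := eq_quo_mul_prod_pow_add_sum_rem_mul_prod_pow (R := ℝ)
    (s := Finset.univ) 1 (g := fun i : Fin q => X + C (a i))
    (fun i _ => monic_X_add_C _) (fun i _ j _ hij => by
      have h : a i - a j ≠ 0 := sub_ne_zero.2 fun h => hij (hinj h)
      refine ⟨C (a i - a j)⁻¹, -C (a i - a j)⁻¹, ?_⟩
      have : C (a i - a j)⁻¹ * (C (a i) - C (a j)) = 1 := by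
        rw [← C_sub, ← C_mul, inv_mul_cancel₀ h, C_1]
      linear_combination this) m
  set W : ℝ[X] := ∏ i, (X + C (a i)) ^ m i with hW
  have hmonic : ∀ s : Finset (Fin q), (∏ i ∈ s, (X + C (a i)) ^ m i).Monic := fun s =>
    monic_prod_of_monic _ _ fun i _ => (monic_X_add_C _).pow _
  have hWdeg : ∀ i, W.natDegree =
      m i + (∏ k ∈ Finset.univ.erase i, (X + C (a k)) ^ m k).natDegree := fun i => by
    rw [hW, ← Finset.mul_prod_erase _ _ (Finset.mem_univ i),
      ((monic_X_add_C _).pow _).natDegree_mul (hmonic _), natDegree_pow, natDegree_X_add_C, mul_one]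
  have hrC : ∀ i j, r i j = C ((r i j).coeff 0) := fun i j => by
    have := hr i (Finset.mem_univ i) j
    rw [degree_X_add_C] at this
    exact eq_C_of_degree_le_zero (Nat.WithBot.lt_one_iff_le_zero.1 this)
  set S : ℝ[X] := ∑ i, ∑ j, r i j * (X + C (a i)) ^ j.1 *
    ∏ k ∈ Finset.univ.erase i, (X + C (a k)) ^ m k with hS
  have hSdeg : S.degree < W.degree := by
    rw [hS]
    refine (degree_sum_le _ _).trans_lt ((Finset.sup_lt_iff
      (bot_lt_iff_ne_bot.2 (by simpa using (hmonic Finset.univ).ne_zero))).2 fun i _ => ?_)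
    refine (degree_sum_le _ _).trans_lt ((Finset.sup_lt_iff
      (bot_lt_iff_ne_bot.2 (by simpa using (hmonic Finset.univ).ne_zero))).2 fun j _ => ?_)
    refine degree_lt_degree ?_
    rw [hrC i j, mul_assoc]
    refine (natDegree_C_mul_le _ _).trans_lt ?_
    rw [((monic_X_add_C _).pow _).natDegree_mul (hmonic _), natDegree_pow, natDegree_X_add_C,
      mul_one, hWdeg i]
    exact Nat.add_lt_add_right j.2 _
  -- Otherwise `Q * W = 1 - S` would have degree at least that of `W`, whereas both 1 and `S` have
  -- smaller degree.
  have hQ : Q = 0 := by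
    by_contra hQ
    obtain ⟨i₀, hi₀⟩ := hdeg
    have h1 : (Q * W).degree < W.degree := by
      have : Q * W = 1 - S := by rw [hf]; ring
      rw [this]
      refine (degree_sub_le _ _).trans_lt (max_lt (degree_lt_degree ?_) hSdeg)
      rw [natDegree_one, hWdeg i₀]
      omega
    exact absurd (degree_le_mul_left W hQ) (by rw [mul_comm]; exact not_le.2 h1)
  refine ⟨fun i j => if h : j < m i then (r i ⟨j, h⟩).coeff 0 else 0, ?_⟩
  rw [hQ, zero_mul, zero_add] at hf
  rw [hf, hS]
  refine Finset.sum_congr rfl fun i _ => ?_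
  rw [Finset.sum_range]
  refine Finset.sum_congr rfl fun j _ => ?_
  simp only [dif_pos j.2]
  rw [← hrC]

/-- Cleared of denominators, the expansion holds for every real t, including the poles. The
coefficient `d i j` belongs to the pole of order `m i - j`. -/
lemma exists_partialFraction {q : ℕ} (lam : Fin q → ℝ) (m : Fin q → ℕ) (hpos : ∀ i, 0 < lam i)
    (hinj : Function.Injective lam) (hdeg : ∃ i, 0 < m i) :
    ∃ d : Fin q → ℕ → ℝ, ∀ t : ℝ, 1 = ∑ i, ∑ j ∈ Finset.range (m i),
      d i j * (1 + lam i * t) ^ j * ∏ k ∈ Finset.univ.erase i, (1 + lam k * t) ^ m k := by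
  obtain ⟨d, hd⟩ := Polynomial.exists_partialFraction_X_add_C (fun i => (lam i)⁻¹) m
    (fun i j h => hinj (inv_injective h)) hdeg
  refine ⟨fun i j => d i j * ((lam i)⁻¹ ^ j * ∏ k ∈ Finset.univ.erase i, (lam k)⁻¹ ^ m k),
    fun t => ?_⟩
  have h := congrArg (Polynomial.eval t) hd
  simp only [Polynomial.eval_one, Polynomial.eval_finsetSum, Polynomial.eval_mul,
    Polynomial.eval_C, Polynomial.eval_pow, Polynomial.eval_add, Polynomial.eval_X,
    Polynomial.eval_prod] at h
  refine h.trans (Finset.sum_congr rfl fun i _ => Finset.sum_congr rfl fun j _ => ?_)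
  have hk : ∀ k, t + (lam k)⁻¹ = (lam k)⁻¹ * (1 + lam k * t) := fun k => by
    field_simp [(hpos k).ne']
    ring
  simp_rw [hk, mul_pow, Finset.prod_mul_distrib]
  ring

/-- The term u^n g(u) contributes nothing to derivatives at 0 of order below n, so the polynomial
part is read off as Taylor coefficients. -/
lemma iteratedDeriv_sum_pow_add_pow_mul {n j : ℕ} (hj : j < n) (d : ℕ → ℝ) {g h : ℝ → ℝ}
    (hg : ContDiffAt ℝ j g 0)
    (hh : h =ᶠ[nhds 0] fun u => ∑ i ∈ Finset.range n, d i * u ^ i + u ^ n * g u) :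
    iteratedDeriv j h 0 = j.factorial * d j := by
  rw [hh.iteratedDeriv_eq, iteratedDeriv_fun_add (by fun_prop)
    (ContDiffAt.mul (by fun_prop) hg), iteratedDeriv_fun_sum fun i _ => by fun_prop,
    iteratedDeriv_fun_mul (by fun_prop) hg]
  have h2 : ∑ i ∈ Finset.range (j + 1), (j.choose i : ℝ) *
      iteratedDeriv i (fun u : ℝ => u ^ n) 0 * iteratedDeriv (j - i) g 0 = 0 :=
    Finset.sum_eq_zero fun i hi => by
      rw [iteratedDeriv_fun_pow_zero, if_neg (by rw [Finset.mem_range] at hi; omega)]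
      simp
  rw [h2, add_zero]
  simp_rw [iteratedDeriv_const_mul_field, iteratedDeriv_fun_pow_zero]
  rw [Finset.sum_eq_single j (fun i _ hi => by simp [hi.symm])
    (fun h => absurd (Finset.mem_range.2 hj) h)]
  simp [mul_comm]

/-- Substituting u = 1 + λ_i t makes the i-th factor u and the others those of `mixtureH`. Dividing
by the latter gives H_i(u) = ∑ d_{i,j} u^j + u^(m_i) g(u), with g smooth at 0 because the λ's are
distinct. -/
lemma mixtureCoeff_eq_of_partialFraction {q : ℕ} {lam : Fin q → ℝ} {m : Fin q → ℕ}
    (hpos : ∀ i, 0 < lam i) (hinj : Function.Injective lam) {d : Fin q → ℕ → ℝ}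
    (hd : ∀ t : ℝ, 1 = ∑ i, ∑ j ∈ Finset.range (m i),
      d i j * (1 + lam i * t) ^ j * ∏ k ∈ Finset.univ.erase i, (1 + lam k * t) ^ m k)
    (i : Fin q) {k : ℕ} (hk : k ∈ Finset.Icc 1 (m i)) :
    mixtureCoeff lam m i k = d i (m i - k) := by
  rw [Finset.mem_Icc] at hk
  have hi := (hpos i).ne'
  set w : Fin q → ℝ → ℝ := fun k u => lam k / lam i * u + 1 - lam k / lam i with hw
  have hwi : ∀ u, w i u = u := fun u => by simp [hw, hi]
  have hwk : ∀ k, k ≠ i → w k 0 ≠ 0 := fun k hk h => by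
    have h1 : lam k / lam i = 1 := by simp only [hw] at h; linarith
    exact hk (hinj ((div_eq_one_iff_eq hi).1 h1))
  have hne : ∀ᶠ u in nhds (0 : ℝ), ∀ k, k ≠ i → w k u ≠ 0 := by
    refine Filter.eventually_all.2 fun k => ?_
    by_cases hki : k = i
    · exact Filter.Eventually.of_forall fun u h => absurd hki h
    · have hc : Continuous (w k) := by fun_prop
      filter_upwards [hc.continuousAt.eventually_ne (hwk k hki)] with u hu _ using hu
  set g : ℝ → ℝ := fun u => (∑ l ∈ Finset.univ.erase i, ∑ j ∈ Finset.range (m l),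
    d l j * w l u ^ j * ∏ k ∈ (Finset.univ.erase l).erase i, w k u ^ m k) *
      ∏ k ∈ Finset.univ.erase i, (w k u ^ m k)⁻¹ with hg
  have hgd : ContDiffAt ℝ (m i - k : ℕ) g 0 := by
    refine ContDiffAt.mul (by fun_prop) (contDiffAt_prod fun k hk => ContDiffAt.inv (by fun_prop)
      (pow_ne_zero _ (hwk k (Finset.ne_of_mem_erase hk))))
  rw [mixtureCoeff, iteratedDeriv_sum_pow_add_pow_mul (n := m i) (by omega) (d i) hgd]
  · field_simp
  · filter_upwards [hne] with u hu
    have hP : (∏ k ∈ Finset.univ.erase i, w k u ^ m k) ≠ 0 :=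
      Finset.prod_ne_zero_iff.2 fun k hk => pow_ne_zero _ (hu k (Finset.ne_of_mem_erase hk))
    have h1 := hd ((u - 1) / lam i)
    have hw' : ∀ k, 1 + lam k * ((u - 1) / lam i) = w k u := fun k => by
      simp only [hw]; field_simp; ring
    simp_rw [hw'] at h1
    rw [← Finset.add_sum_erase _ _ (Finset.mem_univ i)] at h1
    have h2 : ∀ l ∈ Finset.univ.erase i, ∑ j ∈ Finset.range (m l),
        d l j * w l u ^ j * ∏ k ∈ Finset.univ.erase l, w k u ^ m k = u ^ m i *
        ∑ j ∈ Finset.range (m l), d l j * w l u ^ j *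
          ∏ k ∈ (Finset.univ.erase l).erase i, w k u ^ m k := fun l hl => by
      rw [Finset.mul_sum]
      refine Finset.sum_congr rfl fun j _ => ?_
      rw [← Finset.mul_prod_erase _ _ (Finset.mem_erase.2 ⟨(Finset.ne_of_mem_erase hl).symm,
        Finset.mem_univ i⟩), hwi]
      ring
    rw [Finset.sum_congr rfl h2, ← Finset.mul_sum, ← Finset.sum_mul, hwi] at h1
    rw [mixtureH, hg]
    simp only [Finset.prod_inv_distrib]
    rw [← mul_assoc, eq_comm]
    refine eq_inv_of_mul_eq_one_left ?_
    rw [add_mul, inv_mul_cancel_right₀ hP]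
    exact h1.symm

/-- The partial fraction expansion of a product of Gamma Laplace transforms. -/
lemma sum_mixtureCoeff_mul_inv_pow {q : ℕ} {lam : Fin q → ℝ} {m : Fin q → ℕ}
    (hpos : ∀ i, 0 < lam i) (hinj : Function.Injective lam) (hdeg : ∃ i, 0 < m i) {t : ℝ}
    (ht : 0 ≤ t) :
    ∑ i, ∑ k ∈ Finset.Icc 1 (m i), mixtureCoeff lam m i k * ((1 + lam i * t) ^ k)⁻¹ =
      ∏ i, ((1 + lam i * t) ^ m i)⁻¹ := by
  obtain ⟨d, hd⟩ := exists_partialFraction lam m hpos hinj hdeg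
  have hne : ∀ i, 1 + lam i * t ≠ 0 := fun i => by have := hpos i; positivity
  have hP : ∏ i, (1 + lam i * t) ^ m i ≠ 0 :=
    Finset.prod_ne_zero_iff.2 fun i _ => pow_ne_zero _ (hne i)
  rw [Finset.prod_inv_distrib]
  refine eq_inv_of_mul_eq_one_left ?_
  refine Eq.trans ?_ (hd t).symm
  rw [Finset.sum_mul]
  refine Finset.sum_congr rfl fun i _ => ?_
  rw [Finset.sum_mul]
  refine Finset.sum_nbij' (fun k => m i - k) (fun j => m i - j) ?_ ?_ ?_ ?_ fun k hk => ?_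
  · intro k hk; simp only [Finset.mem_Icc, Finset.mem_range] at *; omega
  · intro k hk; simp only [Finset.mem_Icc, Finset.mem_range] at *; omega
  · intro k hk; simp only [Finset.mem_Icc] at *; omega
  · intro k hk; simp only [Finset.mem_range] at *; omega
  · rw [mixtureCoeff_eq_of_partialFraction hpos hinj hd i hk,
      ← Finset.mul_prod_erase _ _ (Finset.mem_univ i),
      ← Nat.sub_add_cancel (Finset.mem_Icc.1 hk).2, pow_add, Nat.add_sub_cancel]
    have := pow_ne_zero k (hne i)
    field_simp

lemma mixtureCoeff_simple {q : ℕ} {lam : Fin q → ℝ} (hpos : ∀ i, 0 < lam i) (i : Fin q) :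
    mixtureCoeff lam (fun _ => 1) i 1 =
      ∏ j ∈ Finset.univ.erase i, lam i / (lam i - lam j) := by
  have hi := (hpos i).ne'
  simp only [mixtureCoeff, mixtureH, Nat.sub_self, Nat.factorial_zero, Nat.cast_one,
    iteratedDeriv_zero, pow_one, mul_zero, zero_add, one_mul, div_one]
  refine Finset.prod_congr rfl fun j _ => ?_
  rw [show 1 - lam j / lam i = (lam i - lam j) / lam i by rw [sub_div, div_self hi], inv_div]

/-- `mixtureH` is an empty product, so only the derivative of order zero survives; `hk` keeps
truncated subtraction from creating further such k. -/
lemma mixtureCoeff_single (lam₁ : ℝ) (m₁ : ℕ) {k : ℕ} (hk : k ≤ m₁) :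
    mixtureCoeff ![lam₁] ![m₁] 0 k = if k = m₁ then 1 else 0 := by
  have h : mixtureH ![lam₁] ![m₁] 0 = fun _ => 1 := by
    ext u
    simp [mixtureH]
  rw [mixtureCoeff, h, iteratedDeriv_const]
  split_ifs with h1 h2 h2
  · simp [h2]
  · simp at h1; omega
  · simp [h2] at h1
  · simp

/-! ### The Mellin transform of `log (1 + 1 / t)` -/

lemma integrableOn_cpow_mul_exp_neg_mul {s : ℂ} (hs : 0 < s.re) {r : ℝ} (hr : 0 < r) :
    IntegrableOn (fun t : ℝ => (t : ℂ) ^ (s - 1) * Complex.exp (-(r * t))) (Set.Ioi 0) := by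
  have h : IntegrableOn (fun t : ℝ => t ^ (s.re - 1) * Real.exp (-(r * t))) (Set.Ioi 0) := by
    refine Integrable.of_integral_ne_zero ?_
    rw [Real.integral_rpow_mul_exp_neg_mul_Ioi hs hr]
    have := Real.Gamma_pos_of_pos hs
    positivity
  refine h.mono' (by fun_prop) ?_
  filter_upwards [ae_restrict_mem measurableSet_Ioi] with t ht
  rw [norm_mul, Complex.norm_cpow_eq_rpow_re_of_pos ht, Complex.norm_exp]
  simp

/-- Justifies Fubini for 1/(t + v) = ∫ e^(-(t+v)z) dz. Integrating the norm in t leaves Γ(Re s)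
z^(-Re s) e^(-vz), integrable at 0 since Re s < 1. -/
lemma integrable_cpow_mul_exp_mul_exp {s : ℂ} (h0 : 0 < s.re) (h1 : s.re < 1) {v : ℝ}
    (hv : 0 < v) :
    Integrable (fun p : ℝ × ℝ => (p.2 : ℂ) ^ (s - 1) * Complex.exp (-(p.1 * p.2)) *
      Complex.exp (-(v * p.1))) ((volume.restrict (Set.Ioi 0)).prod
        (volume.restrict (Set.Ioi 0))) := by
  rw [integrable_prod_iff (by fun_prop)]
  constructor
  · filter_upwards [ae_restrict_mem measurableSet_Ioi] with z hz
    exact (integrableOn_cpow_mul_exp_neg_mul h0 hz).mul_const _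
  · have h : IntegrableOn (fun z : ℝ => z ^ ((1 - s.re) - 1) * Real.exp (-(v * z)) *
        Real.Gamma s.re) (Set.Ioi 0) := by
      refine Integrable.mul_const (Integrable.of_integral_ne_zero ?_) _
      rw [Real.integral_rpow_mul_exp_neg_mul_Ioi (by linarith) hv]
      have := Real.Gamma_pos_of_pos (s := 1 - s.re) (by linarith)
      positivity
    refine h.congr ?_
    filter_upwards [ae_restrict_mem measurableSet_Ioi] with z hz
    have hz' : (0 : ℝ) < z := hz
    have : ∫ t in Set.Ioi (0 : ℝ), ‖(t : ℂ) ^ (s - 1) * Complex.exp (-(z * t)) *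
        Complex.exp (-(v * z))‖ = ∫ t in Set.Ioi (0 : ℝ), t ^ (s.re - 1) * Real.exp (-(z * t)) *
          Real.exp (-(v * z)) := by
      refine setIntegral_congr_fun measurableSet_Ioi fun t ht => ?_
      simp only [norm_mul, Complex.norm_cpow_eq_rpow_re_of_pos ht, Complex.norm_exp]
      simp
    rw [this, integral_mul_const, Real.integral_rpow_mul_exp_neg_mul_Ioi h0 hz,
      show 1 - s.re - 1 = -s.re by ring, Real.rpow_neg hz'.le, one_div, Real.inv_rpow hz'.le]
    ring

lemma integrableOn_cpow_div_add {s : ℂ} (h0 : 0 < s.re) (h1 : s.re < 1) {v : ℝ} (hv : 0 < v) :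
    IntegrableOn (fun t : ℝ => (t : ℂ) ^ (s - 1) * (1 / (t + v))) (Set.Ioi 0) ∧
    ∫ t in Set.Ioi (0 : ℝ), (t : ℂ) ^ (s - 1) * (1 / ((t : ℂ) + v)) =
      Complex.Gamma s * Complex.Gamma (1 - s) * (v : ℂ) ^ (s - 1) := by
  have hF := integrable_cpow_mul_exp_mul_exp h0 h1 hv
  have hinner : ∀ t : ℝ, 0 < t → ∫ z in Set.Ioi (0 : ℝ), (t : ℂ) ^ (s - 1) *
      Complex.exp (-(z * t)) * Complex.exp (-(v * z)) = (t : ℂ) ^ (s - 1) * (1 / (t + v)) :=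
    fun t ht => by
      have := Complex.integral_cpow_mul_exp_neg_mul_Ioi (a := 1) (r := t + v) (by simp)
        (by positivity)
      simp only [sub_self, Complex.cpow_zero, one_mul, Complex.cpow_one, Complex.Gamma_one,
        mul_one] at this
      push_cast at this
      rw [← this, ← integral_const_mul]
      congr with z
      rw [mul_assoc, ← Complex.exp_add]
      ring_nf
  have hinner' : ∀ᵐ t : ℝ ∂(volume.restrict (Set.Ioi (0 : ℝ))), ∫ z in Set.Ioi (0 : ℝ),
      (t : ℂ) ^ (s - 1) * Complex.exp (-(z * t)) * Complex.exp (-(v * z)) =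
        (t : ℂ) ^ (s - 1) * (1 / (t + v)) := by
    filter_upwards [ae_restrict_mem measurableSet_Ioi] with t ht using hinner t ht
  refine ⟨hF.integral_prod_right.congr hinner', ?_⟩
  rw [← integral_congr_ae hinner', ← integral_integral_swap hF]
  have h2 : ∀ᵐ z : ℝ ∂(volume.restrict (Set.Ioi (0 : ℝ))), ∫ t in Set.Ioi (0 : ℝ),
      (t : ℂ) ^ (s - 1) * Complex.exp (-(z * t)) * Complex.exp (-(v * z)) =
        Complex.Gamma s * ((z : ℂ) ^ ((1 - s) - 1) * Complex.exp (-(v * z))) := by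
    filter_upwards [ae_restrict_mem measurableSet_Ioi] with z hz
    have hz' : (0 : ℝ) < z := hz
    rw [integral_mul_const, Complex.integral_cpow_mul_exp_neg_mul_Ioi h0 hz,
      show 1 - s - 1 = -s by ring, one_div, Complex.inv_cpow _ _ (by
        rw [Complex.arg_ofReal_of_nonneg hz'.le]; exact Real.pi_pos.ne), ← Complex.cpow_neg]
    ring
  rw [integral_congr_ae h2, integral_const_mul,
    Complex.integral_cpow_mul_exp_neg_mul_Ioi (by simpa using h1) hv, one_div,
    Complex.inv_cpow _ _ (by
        rw [Complex.arg_ofReal_of_nonneg hv.le]; exact Real.pi_pos.ne), ← Complex.cpow_neg,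
    neg_sub]
  ring

lemma intervalIntegral_one_div_add {t : ℝ} (ht : 0 < t) :
    ∫ v in (0 : ℝ)..1, 1 / (t + v) = Real.log (1 + t⁻¹) := by
  simp_rw [one_div]
  rw [intervalIntegral.integral_comp_add_left (fun x => x⁻¹), add_zero,
    integral_inv_of_pos ht (by linarith)]
  congr 1
  field_simp

/-- The norm of the integrand is the same function at the real exponent Re s, so its t-integral is a
multiple of v^(Re s - 1), integrable on (0, 1]. -/
lemma integrable_cpow_div_add_prod {s : ℂ} (h0 : 0 < s.re) (h1 : s.re < 1) :
    Integrable (fun p : ℝ × ℝ => (p.2 : ℂ) ^ (s - 1) * (1 / (p.2 + p.1)))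
      ((volume.restrict (Set.Ioc 0 1)).prod (volume.restrict (Set.Ioi 0))) := by
  rw [integrable_prod_iff (by fun_prop)]
  constructor
  · filter_upwards [ae_restrict_mem measurableSet_Ioc] with v hv
    exact (integrableOn_cpow_div_add h0 h1 hv.1).1
  · have h : IntegrableOn (fun v : ℝ => ‖Complex.Gamma s.re * Complex.Gamma (1 - s.re) *
        (v : ℂ) ^ ((s.re : ℂ) - 1)‖) (Set.Ioc 0 1) := by
      refine Integrable.norm (Integrable.const_mul ?_ _)
      rw [← IntegrableOn, ← intervalIntegrable_iff_integrableOn_Ioc_of_le zero_le_one]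
      exact intervalIntegral.intervalIntegrable_cpow' (by simpa using h0)
    refine h.congr ?_
    filter_upwards [ae_restrict_mem measurableSet_Ioc] with v hv
    rw [← (integrableOn_cpow_div_add (s := s.re) (by simpa) (by simpa) hv.1).2]
    have hpt : ∀ t ∈ Set.Ioi (0 : ℝ), (t : ℂ) ^ ((s.re : ℂ) - 1) * (1 / ((t : ℂ) + v)) =
        ((‖(t : ℂ) ^ (s - 1) * (1 / ((t : ℂ) + v))‖ : ℝ) : ℂ) := fun t ht => by
      have ht' : (0 : ℝ) < t := ht
      have hv' := hv.1
      rw [norm_mul, Complex.norm_cpow_eq_rpow_re_of_pos ht, ← Complex.ofReal_add,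
        ← Complex.ofReal_one, ← Complex.ofReal_div, Complex.norm_real, Real.norm_of_nonneg
          (by positivity), Complex.ofReal_mul, Complex.ofReal_cpow ht'.le]
      simp
    rw [setIntegral_congr_fun measurableSet_Ioi hpt, integral_complex_ofReal, Complex.norm_real,
      Real.norm_of_nonneg (integral_nonneg fun _ => norm_nonneg _)]

/-- Write log(1 + 1/t) = ∫₀¹ dv/(t + v) and swap; the remaining ∫₀¹ v^(s-1) dv supplies the factor
1/s. -/
lemma hasMellin_log_one_add_inv {s : ℂ} (h0 : 0 < s.re) (h1 : s.re < 1) :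
    HasMellin (fun t : ℝ => (Real.log (1 + t⁻¹) : ℂ)) s
      (Complex.Gamma s * Complex.Gamma (1 - s) / s) := by
  have hG := integrable_cpow_div_add_prod h0 h1
  have hinner : ∀ᵐ t : ℝ ∂(volume.restrict (Set.Ioi (0 : ℝ))), ∫ v in Set.Ioc (0 : ℝ) 1,
      (t : ℂ) ^ (s - 1) * (1 / (t + v)) = (t : ℂ) ^ (s - 1) • (Real.log (1 + t⁻¹) : ℂ) := by
    filter_upwards [ae_restrict_mem measurableSet_Ioi] with t ht
    rw [integral_const_mul, smul_eq_mul, ← intervalIntegral_one_div_add ht,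
      ← intervalIntegral.integral_ofReal, intervalIntegral.integral_of_le zero_le_one]
    push_cast
    rfl
  refine ⟨hG.integral_prod_right.congr hinner, ?_⟩
  rw [mellin, ← integral_congr_ae hinner, ← integral_integral_swap hG]
  rw [setIntegral_congr_fun measurableSet_Ioc
    fun v hv => (integrableOn_cpow_div_add h0 h1 hv.1).2, integral_const_mul,
    ← intervalIntegral.integral_of_le zero_le_one, integral_cpow (Or.inl (by simpa using h0))]
  have hs : s ≠ 0 := by rintro rfl; simp at h0
  simp [hs, Complex.zero_cpow, div_eq_mul_inv]

lemma one_add_sq_le_cosh_pi_mul (y : ℝ) : 1 + y ^ 2 ≤ Real.cosh (Real.pi * y) := by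
  have h1 : Real.cosh (Real.pi * y) = 1 + 2 * Real.sinh (Real.pi * y / 2) ^ 2 := by
    rw [show Real.pi * y = 2 * (Real.pi * y / 2) by ring, Real.cosh_two_mul, Real.cosh_sq]
    ring_nf
  have h2 : (Real.pi * y / 2) ^ 2 ≤ Real.sinh (Real.pi * y / 2) ^ 2 := by
    rw [sq_le_sq]
    rcases le_total 0 (Real.pi * y / 2) with h | h
    · rw [abs_of_nonneg h, abs_of_nonneg (Real.sinh_nonneg_iff.2 h)]
      exact Real.self_le_sinh_iff.2 h
    · rw [abs_of_nonpos h, abs_of_nonpos (Real.sinh_nonpos_iff.2 h)]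
      exact neg_le_neg (Real.sinh_le_self_iff.2 h)
  have h3 : 3 < Real.pi := Real.pi_gt_three
  have h4 : 9 ≤ Real.pi ^ 2 := by nlinarith
  rw [h1]
  nlinarith [mul_le_mul_of_nonneg_right h4 (sq_nonneg y)]

/-- By the reflection formula the numerator is π / sin(πs), and Re sin(π(c + iy)) = sin(πc)
cosh(πy). A quadratic lower bound for cosh already gives an integrable majorant. -/
lemma norm_Gamma_mul_Gamma_one_sub_le {c : ℝ} (h0 : 0 < c) (h1 : c < 1) (y : ℝ) :
    ‖Complex.Gamma (c + y * Complex.I) * Complex.Gamma (1 - (c + y * Complex.I)) /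
      (c + y * Complex.I)‖ ≤ Real.pi / Real.sin (Real.pi * c) / c * (1 + y ^ 2)⁻¹ := by
  have hsin : 0 < Real.sin (Real.pi * c) :=
    Real.sin_pos_of_pos_of_lt_pi (by positivity) (by nlinarith [Real.pi_pos])
  have hre : (Complex.sin (Real.pi * (c + y * Complex.I))).re =
      Real.sin (Real.pi * c) * Real.cosh (Real.pi * y) := by
    rw [show (Real.pi : ℂ) * (c + y * Complex.I) =
      ((Real.pi * c : ℝ) : ℂ) + ((Real.pi * y : ℝ) : ℂ) * Complex.I by push_cast; ring,
      Complex.sin_add_mul_I, ← Complex.ofReal_sin, ← Complex.ofReal_cos, ← Complex.ofReal_cosh,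
      ← Complex.ofReal_sinh]
    simp [-Complex.ofReal_mul, -Complex.ofReal_sin, -Complex.ofReal_cos, -Complex.ofReal_sinh,
      -Complex.ofReal_cosh]
  have hle : Real.sin (Real.pi * c) * (1 + y ^ 2) ≤
      ‖Complex.sin (Real.pi * (c + y * Complex.I))‖ := by
    refine le_trans ?_ (Complex.re_le_norm _)
    rw [hre]
    exact mul_le_mul_of_nonneg_left (one_add_sq_le_cosh_pi_mul y) hsin.le
  have hs : c ≤ ‖(c + y * Complex.I : ℂ)‖ := by
    refine le_trans ?_ (Complex.re_le_norm _)
    simp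
  rw [Complex.Gamma_mul_Gamma_one_sub, norm_div, norm_div, Complex.norm_real,
    Real.norm_of_nonneg Real.pi_pos.le]
  calc Real.pi / ‖Complex.sin (Real.pi * (c + y * Complex.I))‖ / ‖(c + y * Complex.I : ℂ)‖
      ≤ Real.pi / (Real.sin (Real.pi * c) * (1 + y ^ 2)) / c := by gcongr
    _ = _ := by field_simp

lemma continuous_Gamma_vertical {a : ℂ} {b : ℝ → ℂ} (ha : 0 < a.re) (hb : Continuous b)
    (hre : ∀ y, (b y).re = 0) : Continuous fun y : ℝ => Complex.Gamma (a + b y) := by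
  refine continuous_iff_continuousAt.2 fun y => ContinuousAt.comp (f := fun y => a + b y)
    (Complex.differentiableAt_Gamma _ fun m h => ?_).continuousAt (by fun_prop)
  have := congrArg Complex.re h
  rw [Complex.add_re, hre, add_zero, Complex.neg_re, Complex.natCast_re] at this
  have hm : (0 : ℝ) ≤ m := m.cast_nonneg
  linarith

lemma integrable_Gamma_mul_Gamma_one_sub {c : ℝ} (h0 : 0 < c) (h1 : c < 1) :
    Integrable fun y : ℝ => Complex.Gamma (c + y * Complex.I) *
      Complex.Gamma (1 - (c + y * Complex.I)) / (c + y * Complex.I) := by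
  refine (integrable_inv_one_add_sq.const_mul
    (Real.pi / Real.sin (Real.pi * c) / c)).mono' (Continuous.aestronglyMeasurable ?_)
      (Filter.Eventually.of_forall (norm_Gamma_mul_Gamma_one_sub_le h0 h1))
  refine Continuous.div (Continuous.mul ?_ ?_) (by fun_prop) fun y h => ?_
  · exact continuous_Gamma_vertical (by simpa) (by fun_prop) (by simp)
  · simp_rw [← sub_sub, sub_eq_add_neg _ (_ * Complex.I)]
    exact continuous_Gamma_vertical (by simpa) (by fun_prop) (by simp)
  · have := congrArg Complex.re h
    simp at this
    exact h0.ne' this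

/-- The Mellin-Barnes representation of `log (1 + a)`. -/
lemma log_one_add_eq_integral {c : ℝ} (h0 : 0 < c) (h1 : c < 1) {a : ℝ} (ha : 0 < a) :
    (Real.log (1 + a) : ℂ) = (1 / (2 * Real.pi) : ℂ) * ∫ y : ℝ,
      Complex.Gamma (c + y * Complex.I) * Complex.Gamma (1 - (c + y * Complex.I)) /
        (c + y * Complex.I) * (a : ℂ) ^ (c + y * Complex.I : ℂ) := by
  have hM : ∀ y : ℝ, mellin (fun t : ℝ => (Real.log (1 + t⁻¹) : ℂ)) (c + y * Complex.I) =
      Complex.Gamma (c + y * Complex.I) * Complex.Gamma (1 - (c + y * Complex.I)) /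
        (c + y * Complex.I) := fun y =>
    (hasMellin_log_one_add_inv (by simpa) (by simpa)).2
  have hinv : 0 < a⁻¹ := inv_pos.2 ha
  -- Inversion is taken at `a⁻¹`, so that log(1 + 1/t) becomes log(1 + a) and t^(-s) becomes a^s.
  have h := mellinInv_mellin_eq c (fun t : ℝ => (Real.log (1 + t⁻¹) : ℂ)) hinv
    (hasMellin_log_one_add_inv (by simpa) (by simpa)).1
    (by
      rw [Complex.VerticalIntegrable]
      simp_rw [hM]
      exact integrable_Gamma_mul_Gamma_one_sub h0 h1)
    (Complex.continuous_ofReal.continuousAt.comp (ContinuousAt.log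
      (continuousAt_const.add (continuousAt_inv₀ hinv.ne')) (by rw [inv_inv]; positivity)))
  rw [inv_inv] at h
  rw [← h, mellinInv]
  simp_rw [hM, smul_eq_mul]
  rw [Complex.real_smul]
  push_cast
  congr 2
  ext y
  rw [Complex.inv_cpow _ _ (by
    rw [Complex.arg_ofReal_of_nonneg ha.le]; exact Real.pi_pos.ne), ← Complex.cpow_neg, neg_neg,
    mul_comm]

/-! ### Moments of the Gamma distribution -/

/-- The Gamma density is supported on 0 ≤ x; discarding the null point 0 leaves the open half-line
of the Gamma integrals. -/
lemma toReal_gammaPDF_smul {E : Type*} [NormedAddCommGroup E] [NormedSpace ℝ E] {a : ℝ}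
    (ha : 0 < a) (f : ℝ → E) :
    (fun x => (gammaPDF a 1 x).toReal • f x) =ᵐ[volume]
      (Set.Ioi 0).indicator fun x =>
        ((Real.Gamma a)⁻¹ * (x ^ (a - 1) * Real.exp (-x))) • f x := by
  filter_upwards [Measure.ae_ne volume (0 : ℝ)] with x hx
  rw [gammaPDF, ENNReal.toReal_ofReal (gammaPDFReal_nonneg ha one_pos x), gammaPDFReal]
  by_cases h : 0 < x
  · rw [if_pos h.le, Set.indicator_of_mem (Set.mem_Ioi.2 h)]
    simp only [Real.one_rpow, one_mul]
    congr 1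
    ring
  · rw [if_neg (fun h' => h (lt_of_le_of_ne h' hx.symm)),
      Set.indicator_of_notMem (by simpa using h), zero_smul]

lemma integral_gammaMeasure {E : Type*} [NormedAddCommGroup E] [NormedSpace ℝ E] {a : ℝ}
    (ha : 0 < a) (f : ℝ → E) :
    ∫ x, f x ∂(gammaMeasure a 1) =
      ∫ x in Set.Ioi 0, ((Real.Gamma a)⁻¹ * (x ^ (a - 1) * Real.exp (-x))) • f x := by
  have hm : Measurable (gammaPDF a 1) := (measurable_gammaPDFReal a 1).ennreal_ofReal
  rw [gammaMeasure, integral_withDensity_eq_integral_toReal_smul hm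
    (Filter.Eventually.of_forall fun x => ENNReal.ofReal_lt_top),
    integral_congr_ae (toReal_gammaPDF_smul ha f), integral_indicator measurableSet_Ioi]

lemma integrable_gammaMeasure_iff {E : Type*} [NormedAddCommGroup E] [NormedSpace ℝ E] {a : ℝ}
    (ha : 0 < a) (f : ℝ → E) :
    Integrable f (gammaMeasure a 1) ↔ IntegrableOn
      (fun x => ((Real.Gamma a)⁻¹ * (x ^ (a - 1) * Real.exp (-x))) • f x) (Set.Ioi 0) := by
  have hm : Measurable (gammaPDF a 1) := (measurable_gammaPDFReal a 1).ennreal_ofReal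
  rw [gammaMeasure, integrable_withDensity_iff_integrable_smul' hm
    (Filter.Eventually.of_forall fun x => ENNReal.ofReal_lt_top),
    integrable_congr (toReal_gammaPDF_smul ha f), integrable_indicator_iff measurableSet_Ioi]

lemma ae_pos_gammaMeasure (a : ℝ) : ∀ᵐ x ∂(gammaMeasure a 1), 0 < x := by
  have hm : Measurable (gammaPDF a 1) := (measurable_gammaPDFReal a 1).ennreal_ofReal
  rw [gammaMeasure, ae_withDensity_iff hm]
  filter_upwards [Measure.ae_ne volume (0 : ℝ)] with x hx h
  by_contra hx'
  exact h (gammaPDF_of_neg (lt_of_le_of_ne (not_lt.1 hx') hx))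

lemma gammaMeasure_cpow_integrand {a : ℝ} {s : ℂ} :
    Set.EqOn (fun x : ℝ => ((Real.Gamma a)⁻¹ * (x ^ (a - 1) * Real.exp (-x))) • (x : ℂ) ^ s)
      (fun x : ℝ => (Complex.Gamma a)⁻¹ * ((x : ℂ) ^ (a + s - 1) *
        Complex.exp (-((1 : ℝ) * x)))) (Set.Ioi 0) := fun x hx => by
  have hx' : (0 : ℝ) < x := hx
  simp only [Complex.real_smul]
  push_cast
  rw [Complex.ofReal_cpow hx'.le, Complex.Gamma_ofReal,
    show (a : ℂ) + s - 1 = (a - 1) + s by ring,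
    Complex.cpow_add _ _ (Complex.ofReal_ne_zero.2 hx'.ne')]
  push_cast
  ring_nf

lemma integrable_cpow_gammaMeasure {a : ℝ} (ha : 0 < a) {s : ℂ} (hs : 0 < a + s.re) :
    Integrable (fun x : ℝ => (x : ℂ) ^ s) (gammaMeasure a 1) := by
  rw [integrable_gammaMeasure_iff ha, integrableOn_congr_fun gammaMeasure_cpow_integrand
    measurableSet_Ioi]
  exact (integrableOn_cpow_mul_exp_neg_mul (by simpa using hs) one_pos).const_mul _

lemma integral_cpow_gammaMeasure {a : ℝ} (ha : 0 < a) {s : ℂ} (hs : 0 < a + s.re) :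
    ∫ x : ℝ, (x : ℂ) ^ s ∂(gammaMeasure a 1) = Complex.Gamma (a + s) / Complex.Gamma a := by
  rw [integral_gammaMeasure ha, setIntegral_congr_fun measurableSet_Ioi gammaMeasure_cpow_integrand,
    integral_const_mul, Complex.integral_cpow_mul_exp_neg_mul_Ioi (by simpa using hs) one_pos]
  simp [div_eq_mul_inv, mul_comm]

lemma integral_norm_cpow_gammaMeasure (a : ℝ) (s : ℂ) :
    ∫ x : ℝ, ‖(x : ℂ) ^ s‖ ∂(gammaMeasure a 1) = ∫ x : ℝ, x ^ s.re ∂(gammaMeasure a 1) := by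
  refine integral_congr_ae ?_
  filter_upwards [ae_pos_gammaMeasure a] with x hx
  exact Complex.norm_cpow_eq_rpow_re_of_pos hx _

lemma integrable_id_gammaMeasure {a : ℝ} (ha : 0 < a) :
    Integrable (fun x : ℝ => x) (gammaMeasure a 1) := by
  have := (integrable_cpow_gammaMeasure ha (s := 1) (by simp; linarith)).re
  simpa using this

lemma integral_exp_neg_mul_gammaMeasure {k : ℕ} (hk : 1 ≤ k) {t : ℝ} (ht : 0 ≤ t) :
    ∫ x, Real.exp (-(t * x)) ∂(gammaMeasure k 1) = ((1 + t) ^ k)⁻¹ := by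
  have hk' : (0 : ℝ) < k := by exact_mod_cast hk
  rw [integral_gammaMeasure hk']
  have h : ∀ x : ℝ, ((Real.Gamma k)⁻¹ * (x ^ ((k : ℝ) - 1) * Real.exp (-x))) •
      Real.exp (-(t * x)) =
      (Real.Gamma k)⁻¹ * (x ^ ((k : ℝ) - 1) * Real.exp (-((1 + t) * x))) := fun x => by
    rw [smul_eq_mul, mul_assoc, mul_assoc, ← Real.exp_add]
    ring_nf
  simp_rw [h]
  rw [integral_const_mul, Real.integral_rpow_mul_exp_neg_mul_Ioi hk' (by positivity)]
  have := (Real.Gamma_pos_of_pos hk').ne'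
  rw [Real.rpow_natCast, one_div, inv_pow]
  field_simp

/-! ### The Meijer G-function as an expectation -/

/-- The lower parameter 0 cancels the upper parameter 0, leaving Γ(1-s) Γ(k+s) Γ(s)². One Γ(s) is
written as Γ(1+s)/s to exhibit the kernel of log(1 + a) times two Gamma moments. -/
lemma meijerGIntegrand_capacity (k : ℕ) (z : ℂ) {s : ℂ} (h0 : 0 < s.re) :
    meijerGIntegrand 1 4 ![1 - (k : ℂ), 0, 1, 1] ![1, 0] z s =
      Complex.Gamma s * Complex.Gamma (1 - s) / s * z ^ s *
        (Complex.Gamma (k + s) * Complex.Gamma (1 + s)) := by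
  have hs : s ≠ 0 := by rintro rfl; simp at h0
  have h1 : Complex.Gamma (1 + s) = s * Complex.Gamma s := by
    rw [add_comm, Complex.Gamma_add_one s hs]
  have h2 := Complex.Gamma_ne_zero_of_re_pos h0
  simp only [meijerGIntegrand, Fin.prod_univ_four, Fin.prod_univ_two]
  simp [h1]
  field_simp

lemma meijerGSeparates_capacity_iff {k : ℕ} (hk : 1 ≤ k) (c : ℝ) :
    MeijerGSeparates 1 4 ![1 - (k : ℂ), 0, 1, 1] ![1, 0] c ↔ 0 < c ∧ c < 1 := by
  have hk' : (1 : ℝ) ≤ k := by exact_mod_cast hk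
  constructor
  · rintro ⟨h1, h2⟩
    -- The extreme poles are s = 0, from an upper parameter 1, and s = 1, from the lower parameter
    -- 1.
    exact ⟨by simpa using h2 2 (by decide) 0, by simpa using h1 0 (by decide) 0⟩
  · rintro ⟨h0, h1⟩
    refine ⟨fun j hj l => ?_, fun j _ l => ?_⟩
    · have : j = 0 := by ext; simpa using hj
      have hl : (0 : ℝ) ≤ l := l.cast_nonneg
      subst this
      simp
      linarith
    · have hl : (0 : ℝ) ≤ l := l.cast_nonneg
      fin_cases j <;> simp <;> linarith

/-- On the line Re s = c the powers have norms independent of the height, so the norm separates into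
an integrable kernel and finite c-th moments. -/
lemma integrable_mellinBarnes_prod {k : ℕ} (hk : 1 ≤ k) {x : ℝ} (hx : 0 < x) {c : ℝ} (h0 : 0 < c)
    (h1 : c < 1) :
    Integrable (fun p : ℝ × (ℝ × ℝ) => Complex.Gamma (c + p.1 * Complex.I) *
      Complex.Gamma (1 - (c + p.1 * Complex.I)) / (c + p.1 * Complex.I) *
        (x : ℂ) ^ (c + p.1 * Complex.I) * ((p.2.1 : ℂ) ^ (c + p.1 * Complex.I) *
          (p.2.2 : ℂ) ^ (c + p.1 * Complex.I)))
      (volume.prod ((gammaMeasure k 1).prod (gammaMeasure 1 1))) := by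
  have hk' : (0 : ℝ) < k := by exact_mod_cast hk
  have : IsProbabilityMeasure (gammaMeasure k 1) := isProbabilityMeasure_gammaMeasure hk' one_pos
  have : IsProbabilityMeasure (gammaMeasure 1 1) :=
    isProbabilityMeasure_gammaMeasure one_pos one_pos
  have hM : Integrable fun y : ℝ => Complex.Gamma (c + y * Complex.I) *
      Complex.Gamma (1 - (c + y * Complex.I)) / (c + y * Complex.I) *
        (x : ℂ) ^ (c + y * Complex.I) := by
    refine (integrable_Gamma_mul_Gamma_one_sub h0 h1).mul_bdd (c := x ^ c)
      (Measurable.aestronglyMeasurable (by fun_prop)) (Filter.Eventually.of_forall fun y => ?_)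
    rw [Complex.norm_cpow_eq_rpow_re_of_pos hx]
    simp
  refine (integrable_prod_iff ?_).2 ⟨?_, ?_⟩
  · exact hM.aestronglyMeasurable.comp_fst.mul (Measurable.aestronglyMeasurable (by fun_prop))
  · refine Filter.Eventually.of_forall fun y => ?_
    have h := (integrable_cpow_gammaMeasure hk' (s := c + y * Complex.I) (by
      simp; linarith)).mul_prod (integrable_cpow_gammaMeasure one_pos (s := c + y * Complex.I) (by
        simp; linarith))
    dsimp only
    exact h.const_mul _
  · simp_rw [norm_mul _ (_ * _ : ℂ), integral_const_mul, norm_mul (_ ^ (_ : ℂ) : ℂ) (_ ^ (_ : ℂ) : ℂ)]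
    have : ∀ y : ℝ, ∫ p : ℝ × ℝ, ‖(p.1 : ℂ) ^ (c + y * Complex.I : ℂ)‖ *
        ‖(p.2 : ℂ) ^ (c + y * Complex.I : ℂ)‖ ∂((gammaMeasure k 1).prod (gammaMeasure 1 1)) =
        (∫ x : ℝ, x ^ c ∂(gammaMeasure k 1)) * ∫ x : ℝ, x ^ c ∂(gammaMeasure 1 1) := fun y => by
      rw [integral_prod_mul (fun p : ℝ => ‖(p : ℂ) ^ (c + y * Complex.I : ℂ)‖)
        (fun p : ℝ => ‖(p : ℂ) ^ (c + y * Complex.I : ℂ)‖), integral_norm_cpow_gammaMeasure,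
        integral_norm_cpow_gammaMeasure]
      simp
    simp_rw [this]
    exact hM.norm.mul_const _

lemma mellinBarnes_capacity {k : ℕ} (hk : 1 ≤ k) {x : ℝ} (hx : 0 < x) {c : ℝ} (h0 : 0 < c)
    (h1 : c < 1) :
    Integrable (fun t : ℝ => meijerGIntegrand 1 4 ![1 - (k : ℂ), 0, 1, 1] ![1, 0] x
      (c + t * Complex.I)) ∧
    meijerGLineIntegral 1 4 ![1 - (k : ℂ), 0, 1, 1] ![1, 0] x c = Complex.Gamma k *
      ((∫ p : ℝ × ℝ, Real.log (1 + x * (p.1 * p.2))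
        ∂((gammaMeasure k 1).prod (gammaMeasure 1 1)) : ℝ) : ℂ) := by
  have hk' : (0 : ℝ) < k := by exact_mod_cast hk
  have : IsProbabilityMeasure (gammaMeasure k 1) := isProbabilityMeasure_gammaMeasure hk' one_pos
  have : IsProbabilityMeasure (gammaMeasure 1 1) :=
    isProbabilityMeasure_gammaMeasure one_pos one_pos
  have hK := integrable_mellinBarnes_prod hk hx h0 h1
  have hΓ : Complex.Gamma k ≠ 0 := Complex.Gamma_ne_zero_of_re_pos (by simpa using hk')
  have hG : ∀ t : ℝ, meijerGIntegrand 1 4 ![1 - (k : ℂ), 0, 1, 1] ![1, 0] x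
      (c + t * Complex.I) = Complex.Gamma k * ∫ p : ℝ × ℝ, Complex.Gamma (c + t * Complex.I) *
      Complex.Gamma (1 - (c + t * Complex.I)) / (c + t * Complex.I) *
        (x : ℂ) ^ (c + t * Complex.I : ℂ) * ((p.1 : ℂ) ^ (c + t * Complex.I : ℂ) *
          (p.2 : ℂ) ^ (c + t * Complex.I : ℂ)) ∂((gammaMeasure k 1).prod (gammaMeasure 1 1)) :=
    fun t => by
    rw [meijerGIntegrand_capacity k x (by simpa), integral_const_mul,
      integral_prod_mul (fun p : ℝ => (p : ℂ) ^ (c + t * Complex.I : ℂ))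
        (fun p : ℝ => (p : ℂ) ^ (c + t * Complex.I : ℂ)),
      integral_cpow_gammaMeasure hk' (by simp; linarith),
      integral_cpow_gammaMeasure one_pos (by simp; linarith)]
    push_cast
    rw [Complex.Gamma_one]
    field_simp
  constructor
  · simp_rw [hG]
    exact hK.integral_prod_left.const_mul _
  · rw [meijerGLineIntegral]
    simp_rw [hG]
    rw [integral_const_mul, integral_integral_swap hK, ← integral_complex_ofReal, mul_left_comm,
      ← integral_const_mul (1 / (2 * Real.pi) : ℂ)]
    congr 1
    refine integral_congr_ae ?_
    filter_upwards [Measure.quasiMeasurePreserving_fst.ae (ae_pos_gammaMeasure k),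
      Measure.quasiMeasurePreserving_snd.ae (ae_pos_gammaMeasure 1)] with p hp1 hp2
    rw [log_one_add_eq_integral h0 h1 (by positivity)]
    congr 2
    ext y
    rw [Complex.ofReal_mul, Complex.mul_cpow_ofReal_nonneg hx.le (by positivity),
      Complex.ofReal_mul, Complex.mul_cpow_ofReal_nonneg hp1.le hp2.le, mul_assoc _ (_ ^ _ : ℂ)]

lemma meijerG_capacity {k : ℕ} (hk : 1 ≤ k) {x : ℝ} (hx : 0 < x) :
    meijerG 1 4 ![1 - (k : ℂ), 0, 1, 1] ![1, 0] x = Complex.Gamma k *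
      ((∫ p : ℝ × ℝ, Real.log (1 + x * (p.1 * p.2))
        ∂((gammaMeasure k 1).prod (gammaMeasure 1 1)) : ℝ) : ℂ) := by
  have hex : ∃ c : ℝ, MeijerGSeparates 1 4 ![1 - (k : ℂ), 0, 1, 1] ![1, 0] c :=
    ⟨1 / 2, (meijerGSeparates_capacity_iff hk _).2 (by norm_num)⟩
  rw [meijerG, dif_pos hex]
  have h := (meijerGSeparates_capacity_iff hk _).1 hex.choose_spec
  exact (mellinBarnes_capacity hk hx h.1 h.2).2

/-- Every admissible line yields the same expectation, so no contour shift by Cauchy's theorem is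
needed and the choice inside `meijerG` is immaterial. -/
lemma meijerGWellDefined_capacity {k : ℕ} (hk : 1 ≤ k) {x : ℝ} (hx : 0 < x) :
    MeijerGWellDefined 1 4 ![1 - (k : ℂ), 0, 1, 1] ![1, 0] (x : ℂ) := by
  refine ⟨⟨1 / 2, (meijerGSeparates_capacity_iff hk _).2 (by norm_num)⟩, fun c hc => ?_⟩
  rw [meijerGSeparates_capacity_iff hk] at hc
  have h := mellinBarnes_capacity hk hx hc.1 hc.2
  exact ⟨h.1, (meijerG_capacity hk hx).trans h.2.symm⟩

lemma integrable_log_gammaMeasure_prod {k : ℕ} (hk : 1 ≤ k) {x : ℝ} (hx : 0 ≤ x) :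
    Integrable (fun p : ℝ × ℝ => Real.log (1 + x * (p.1 * p.2)))
      ((gammaMeasure k 1).prod (gammaMeasure 1 1)) := by
  have hk' : (0 : ℝ) < k := by exact_mod_cast hk
  have : IsProbabilityMeasure (gammaMeasure k 1) := isProbabilityMeasure_gammaMeasure hk' one_pos
  have : IsProbabilityMeasure (gammaMeasure 1 1) :=
    isProbabilityMeasure_gammaMeasure one_pos one_pos
  refine (((integrable_id_gammaMeasure hk').mul_prod
    (integrable_id_gammaMeasure one_pos)).const_mul x).mono'
    (Measurable.aestronglyMeasurable (by fun_prop)) ?_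
  filter_upwards [Measure.quasiMeasurePreserving_fst.ae (ae_pos_gammaMeasure k),
    Measure.quasiMeasurePreserving_snd.ae (ae_pos_gammaMeasure 1)] with p hp1 hp2
  have h : 0 ≤ x * (p.1 * p.2) := by positivity
  rw [Real.norm_of_nonneg (Real.log_nonneg (by linarith))]
  linarith [Real.log_le_sub_one_of_pos (show 0 < 1 + x * (p.1 * p.2) by positivity)]

/-! ### Logarithmic expectations through Laplace transforms -/

lemma lintegral_exp_neg_mul_Ioi {r : ℝ} (hr : 0 < r) :
    ∫⁻ y in Set.Ioi (0 : ℝ), ENNReal.ofReal (Real.exp (-(r * y))) = ENNReal.ofReal (1 / r) := by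
  have h : IntegrableOn (fun y : ℝ => Real.exp (-(r * y))) (Set.Ioi 0) := by
    simpa using integrableOn_exp_mul_Ioi (neg_lt_zero.2 hr) 0
  rw [← ofReal_integral_eq_lintegral_ofReal h (Filter.Eventually.of_forall fun _ =>
    (Real.exp_pos _).le)]
  have := integral_exp_mul_Ioi (neg_lt_zero.2 hr) 0
  simp only [neg_mul] at this
  rw [this]
  simp

lemma intervalIntegral_exp_neg_one_add_mul {x y : ℝ} (hy : 0 < y) :
    ∫ v in (0 : ℝ)..x, Real.exp (-((1 + v) * y)) =
      Real.exp (-y) / y * (1 - Real.exp (-(x * y))) := by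
  have h : ∀ v : ℝ, Real.exp (-((1 + v) * y)) = Real.exp (-y) * Real.exp (-y * v) := fun v => by
    rw [← Real.exp_add]
    ring_nf
  simp_rw [h]
  rw [intervalIntegral.integral_const_mul,
    intervalIntegral.integral_comp_mul_left (fun u => Real.exp u) (neg_ne_zero.2 hy.ne'),
    integral_exp, smul_eq_mul, mul_zero, Real.exp_zero, mul_comm x y, ← neg_mul]
  field_simp
  ring

/-- Frullani's representation of `log (1 + x)`. -/
lemma ofReal_log_one_add_eq_lintegral {x : ℝ} (hx : 0 ≤ x) :
    ENNReal.ofReal (Real.log (1 + x)) = ∫⁻ y in Set.Ioi (0 : ℝ),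
      ENNReal.ofReal (Real.exp (-y) / y * (1 - Real.exp (-(x * y)))) := by
  have h1 : Real.log (1 + x) = ∫ v in Set.Ioc (0 : ℝ) x, 1 / (1 + v) := by
    rw [← intervalIntegral.integral_of_le hx]
    simp_rw [one_div]
    rw [intervalIntegral.integral_comp_add_left (fun x => x⁻¹), add_zero,
      integral_inv_of_pos one_pos (by linarith), div_one]
  have hint : IntegrableOn (fun v : ℝ => 1 / (1 + v)) (Set.Ioc 0 x) := by
    refine IntegrableOn.mono_set (ContinuousOn.integrableOn_Icc (ContinuousOn.div (by fun_prop)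
      (by fun_prop) fun v hv => ?_)) Set.Ioc_subset_Icc_self
    have := hv.1
    positivity
  have h2 : ENNReal.ofReal (Real.log (1 + x)) = ∫⁻ v in Set.Ioc (0 : ℝ) x,
      ∫⁻ y in Set.Ioi (0 : ℝ), ENNReal.ofReal (Real.exp (-((1 + v) * y))) := by
    rw [h1, ofReal_integral_eq_lintegral_ofReal hint]
    · refine setLIntegral_congr_fun measurableSet_Ioc fun v hv => ?_
      have := hv.1
      exact (lintegral_exp_neg_mul_Ioi (by positivity)).symm
    · filter_upwards [ae_restrict_mem measurableSet_Ioc] with v hv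
      have := hv.1
      simp only [Pi.zero_apply]
      positivity
  rw [h2, lintegral_lintegral_swap (by fun_prop)]
  refine setLIntegral_congr_fun measurableSet_Ioi fun y hy => ?_
  rw [← intervalIntegral_exp_neg_one_add_mul hy, intervalIntegral.integral_of_le hx,
    ofReal_integral_eq_lintegral_ofReal _ (Filter.Eventually.of_forall fun _ =>
      (Real.exp_pos _).le)]
  exact (Continuous.integrableOn_Icc (by fun_prop)).mono_set Set.Ioc_subset_Icc_self

lemma ae_log_one_add_nonneg {α : Type*} [MeasurableSpace α] (μ : Measure α) {X : α → ℝ}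
    (h0 : ∀ᵐ a ∂μ, 0 ≤ X a) :
    0 ≤ᵐ[μ] fun a => Real.log (1 + X a) := by
  filter_upwards [h0] with a ha using Real.log_nonneg (by linarith)

section LaplaceLog

variable {α : Type*} [MeasurableSpace α] (μ : Measure α) [IsProbabilityMeasure μ] {X : α → ℝ}

lemma integrable_exp_neg_mul_of_nonneg (hX : Measurable X) (h0 : ∀ᵐ a ∂μ, 0 ≤ X a) {y : ℝ}
    (hy : 0 ≤ y) : Integrable (fun a => Real.exp (-(X a * y))) μ := by
  refine Integrable.of_bound (C := 1) (Measurable.aestronglyMeasurable (by fun_prop)) ?_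
  filter_upwards [h0] with a ha
  rw [Real.norm_of_nonneg (Real.exp_pos _).le, Real.exp_le_one_iff]
  nlinarith

lemma integral_exp_neg_mul_le_one (h0 : ∀ᵐ a ∂μ, 0 ≤ X a) {y : ℝ} (hy : 0 ≤ y) :
    ∫ a, Real.exp (-(X a * y)) ∂μ ≤ 1 := by
  have h : ∫ a, Real.exp (-(X a * y)) ∂μ ≤ ∫ _, 1 ∂μ := by
    refine integral_mono_of_nonneg (Filter.Eventually.of_forall fun _ => (Real.exp_pos _).le)
      (integrable_const _) ?_
    filter_upwards [h0] with a ha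
    rw [Real.exp_le_one_iff]
    nlinarith
  simpa using h

/-- Frullani's kernel is nonnegative, so Tonelli applies with no integrability assumption;
finiteness of the two sides is then equivalent. -/
lemma lintegral_log_one_add_eq (hX : Measurable X) (h0 : ∀ᵐ a ∂μ, 0 ≤ X a) :
    ∫⁻ a, ENNReal.ofReal (Real.log (1 + X a)) ∂μ = ∫⁻ y in Set.Ioi (0 : ℝ),
      ENNReal.ofReal (Real.exp (-y) / y * (1 - ∫ a, Real.exp (-(X a * y)) ∂μ)) := by
  have h1 : ∫⁻ a, ENNReal.ofReal (Real.log (1 + X a)) ∂μ = ∫⁻ a, (∫⁻ y in Set.Ioi (0 : ℝ),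
      ENNReal.ofReal (Real.exp (-y) / y * (1 - Real.exp (-(X a * y))))) ∂μ := by
    refine lintegral_congr_ae ?_
    filter_upwards [h0] with a ha using ofReal_log_one_add_eq_lintegral ha
  rw [h1, lintegral_lintegral_swap (Measurable.aemeasurable (by fun_prop))]
  refine setLIntegral_congr_fun measurableSet_Ioi fun y hy => ?_
  have hy' : (0 : ℝ) < y := hy
  have hi := integrable_exp_neg_mul_of_nonneg μ hX h0 hy'.le
  have h2 : 1 - ∫ a, Real.exp (-(X a * y)) ∂μ = ∫ a, (1 - Real.exp (-(X a * y))) ∂μ := by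
    rw [integral_sub (integrable_const _) hi]
    simp
  rw [h2, ← integral_const_mul, ofReal_integral_eq_lintegral_ofReal]
  · exact ((integrable_const _).sub hi).const_mul _
  · filter_upwards [h0] with a ha
    have : Real.exp (-(X a * y)) ≤ 1 := by
      rw [Real.exp_le_one_iff]
      nlinarith
    exact mul_nonneg (by positivity) (by linarith)

lemma ae_laplace_kernel_nonneg (h0 : ∀ᵐ a ∂μ, 0 ≤ X a) :
    0 ≤ᵐ[volume.restrict (Set.Ioi (0 : ℝ))]
      fun y => Real.exp (-y) / y * (1 - ∫ a, Real.exp (-(X a * y)) ∂μ) := by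
  filter_upwards [ae_restrict_mem measurableSet_Ioi] with y hy
  have hy' : (0 : ℝ) < y := hy
  exact mul_nonneg (by positivity) (sub_nonneg.2 (integral_exp_neg_mul_le_one μ h0 hy'.le))

lemma aestronglyMeasurable_laplace_kernel (hX : Measurable X) :
    AEStronglyMeasurable (fun y => Real.exp (-y) / y * (1 - ∫ a, Real.exp (-(X a * y)) ∂μ))
      (volume.restrict (Set.Ioi (0 : ℝ))) := by
  have h : StronglyMeasurable fun y : ℝ => ∫ a, Real.exp (-(X a * y)) ∂μ :=
    StronglyMeasurable.integral_prod_right' (f := fun p : ℝ × α => Real.exp (-(X p.2 * p.1)))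
      (Measurable.stronglyMeasurable (by fun_prop))
  have hm := h.measurable
  exact Measurable.aestronglyMeasurable (by fun_prop)

lemma integrable_log_one_add_iff (hX : Measurable X) (h0 : ∀ᵐ a ∂μ, 0 ≤ X a) :
    Integrable (fun a => Real.log (1 + X a)) μ ↔
      IntegrableOn (fun y => Real.exp (-y) / y * (1 - ∫ a, Real.exp (-(X a * y)) ∂μ))
        (Set.Ioi 0) := by
  rw [IntegrableOn, ← lintegral_ofReal_ne_top_iff_integrable
    (Measurable.aestronglyMeasurable (by fun_prop)) (ae_log_one_add_nonneg μ h0),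
    ← lintegral_ofReal_ne_top_iff_integrable (aestronglyMeasurable_laplace_kernel μ hX)
      (ae_laplace_kernel_nonneg μ h0), lintegral_log_one_add_eq μ hX h0]

lemma integral_log_one_add_eq (hX : Measurable X) (h0 : ∀ᵐ a ∂μ, 0 ≤ X a) :
    ∫ a, Real.log (1 + X a) ∂μ = ∫ y in Set.Ioi (0 : ℝ),
      Real.exp (-y) / y * (1 - ∫ a, Real.exp (-(X a * y)) ∂μ) := by
  rw [integral_eq_lintegral_of_nonneg_ae (ae_log_one_add_nonneg μ h0)
    (Measurable.aestronglyMeasurable (by fun_prop)),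
    integral_eq_lintegral_of_nonneg_ae (ae_laplace_kernel_nonneg μ h0)
      (aestronglyMeasurable_laplace_kernel μ hX), lintegral_log_one_add_eq μ hX h0]

/-- If `1 - E[exp (-yX)]` is a linear combination of the `1 - E[exp (-yX_j)]`, then
`E[log (1 + X)]` is the same linear combination of the `E[log (1 + X_j)]`. -/
lemma integral_log_one_add_eq_sum (hX : Measurable X) (h0 : ∀ᵐ a ∂μ, 0 ≤ X a)
    {J β : Type*} [MeasurableSpace β] (s : Finset J) (w : J → ℝ) (ν : J → Measure β)
    (hν : ∀ j ∈ s, IsProbabilityMeasure (ν j)) (Y : J → β → ℝ) (hY : ∀ j, Measurable (Y j))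
    (hY0 : ∀ j ∈ s, ∀ᵐ b ∂(ν j), 0 ≤ Y j b)
    (hYi : ∀ j ∈ s, Integrable (fun b => Real.log (1 + Y j b)) (ν j))
    (hL : ∀ y : ℝ, 0 < y → 1 - ∫ a, Real.exp (-(X a * y)) ∂μ =
      ∑ j ∈ s, w j * (1 - ∫ b, Real.exp (-(Y j b * y)) ∂(ν j))) :
    Integrable (fun a => Real.log (1 + X a)) μ ∧
    ∫ a, Real.log (1 + X a) ∂μ = ∑ j ∈ s, w j * ∫ b, Real.log (1 + Y j b) ∂(ν j) := by
  have hpt : Set.EqOn (fun y => Real.exp (-y) / y * (1 - ∫ a, Real.exp (-(X a * y)) ∂μ))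
      (fun y => ∑ j ∈ s, w j * (Real.exp (-y) / y *
        (1 - ∫ b, Real.exp (-(Y j b * y)) ∂(ν j)))) (Set.Ioi 0) := fun y hy => by
    simp only
    rw [hL y hy, Finset.mul_sum]
    exact Finset.sum_congr rfl fun j _ => by ring
  -- The weights may be negative, so the sum is split by integrability of each term instead of by
  -- positivity.
  have hi : ∀ j ∈ s, IntegrableOn (fun y => w j * (Real.exp (-y) / y *
        (1 - ∫ b, Real.exp (-(Y j b * y)) ∂(ν j)))) (Set.Ioi 0) := fun j hj => by
    have := hν j hj
    exact ((integrable_log_one_add_iff (ν j) (hY j) (hY0 j hj)).1 (hYi j hj)).const_mul _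
  constructor
  · rw [integrable_log_one_add_iff μ hX h0, integrableOn_congr_fun hpt measurableSet_Ioi]
    exact integrable_finsetSum _ hi
  · rw [integral_log_one_add_eq μ hX h0, setIntegral_congr_fun measurableSet_Ioi hpt,
      integral_finsetSum _ hi]
    refine Finset.sum_congr rfl fun j hj => ?_
    have := hν j hj
    rw [integral_const_mul, integral_log_one_add_eq (ν j) (hY j) (hY0 j hj)]

end LaplaceLog

/-! ### The complex Gaussian law -/

instance : IsProbabilityMeasure stdComplexGaussian :=
  Measure.isProbabilityMeasure_map (Measurable.aemeasurable (by fun_prop))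

instance {ι : Type*} [Fintype ι] : IsProbabilityMeasure (stdComplexGaussianVec ι) := by
  unfold stdComplexGaussianVec
  infer_instance

lemma integral_exp_neg_mul_sq_gaussianReal {t : ℝ} (ht : 0 ≤ t) :
    ∫ x, Real.exp (-(t * x ^ 2)) ∂(gaussianReal 0 (1 / 2)) = (Real.sqrt (1 + t))⁻¹ := by
  rw [integral_gaussianReal_eq_integral_smul (by norm_num)]
  have h : ∀ x : ℝ, gaussianPDFReal 0 (1 / 2) x • Real.exp (-(t * x ^ 2)) =
      (Real.sqrt Real.pi)⁻¹ * Real.exp (-(1 + t) * x ^ 2) := fun x => by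
    rw [gaussianPDFReal, smul_eq_mul, mul_assoc, ← Real.exp_add]
    push_cast
    congr 2 <;> ring_nf
  simp_rw [h]
  rw [integral_const_mul, integral_gaussian, Real.sqrt_div Real.pi_pos.le]
  have := (Real.sqrt_pos.2 Real.pi_pos).ne'
  field_simp

lemma integral_exp_neg_mul_norm_sq_stdComplexGaussian {t : ℝ} (ht : 0 ≤ t) :
    ∫ z, Real.exp (-(t * ‖z‖ ^ 2)) ∂stdComplexGaussian = (1 + t)⁻¹ := by
  rw [stdComplexGaussian, integral_map (Measurable.aemeasurable (by fun_prop))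
    (Measurable.aestronglyMeasurable (by fun_prop))]
  have h : ∀ x : ℝ × ℝ, Real.exp (-(t * ‖(x.1 : ℂ) + (x.2 : ℂ) * Complex.I‖ ^ 2)) =
      Real.exp (-(t * x.1 ^ 2)) * Real.exp (-(t * x.2 ^ 2)) := fun x => by
    rw [← Complex.normSq_eq_norm_sq, Complex.normSq_add_mul_I, ← Real.exp_add]
    ring_nf
  simp_rw [h]
  rw [integral_prod_mul (fun x : ℝ => Real.exp (-(t * x ^ 2)))
    (fun x : ℝ => Real.exp (-(t * x ^ 2))), integral_exp_neg_mul_sq_gaussianReal ht,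
    ← mul_inv, Real.mul_self_sqrt (by positivity)]

lemma charFunDual_stdComplexGaussian (L : StrongDual ℝ ℂ) (a : ℂ) (hL : ∀ z, L z = (a * z).re) :
    charFunDual stdComplexGaussian L = Complex.exp (-((‖a‖ ^ 2 / 4 : ℝ) : ℂ)) := by
  rw [charFunDual_apply, stdComplexGaussian, integral_map (Measurable.aemeasurable (by fun_prop))
    (Measurable.aestronglyMeasurable (by fun_prop))]
  have h : ∀ x : ℝ × ℝ, Complex.exp (L ((x.1 : ℂ) + (x.2 : ℂ) * Complex.I) * Complex.I) =
      Complex.exp ((a.re : ℂ) * x.1 * Complex.I) *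
        Complex.exp (((-a.im : ℝ) : ℂ) * x.2 * Complex.I) := fun x => by
    rw [hL, ← Complex.exp_add]
    simp
    ring_nf
  simp_rw [h]
  rw [integral_prod_mul (fun x : ℝ => Complex.exp ((a.re : ℂ) * x * Complex.I))
    (fun x : ℝ => Complex.exp (((-a.im : ℝ) : ℂ) * x * Complex.I)), ← charFun_apply_real,
    ← charFun_apply_real, charFun_gaussianReal, charFun_gaussianReal, ← Complex.exp_add,
    ← Complex.normSq_eq_norm_sq, Complex.normSq_apply]
  push_cast
  ring_nf

lemma sum_norm_sq_eq_dotProduct {ι : Type*} [Fintype ι] (a : ι → ℂ) :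
    ((∑ i, ‖a i‖ ^ 2 : ℝ) : ℂ) = star a ⬝ᵥ a := by
  simp [dotProduct, Complex.conj_mul']

section Vector

variable {ι : Type*} [Fintype ι] [DecidableEq ι]

lemma charFunDual_stdComplexGaussianVec (L : StrongDual ℝ (ι → ℂ)) (a : ι → ℂ)
    (hL : ∀ v, L v = (a ⬝ᵥ v).re) :
    charFunDual (stdComplexGaussianVec ι) L = Complex.exp (-(((∑ i, ‖a i‖ ^ 2) / 4 : ℝ) : ℂ)) := by
  rw [stdComplexGaussianVec, charFunDual_pi, Finset.prod_congr rfl fun i _ =>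
    charFunDual_stdComplexGaussian _ (a i) fun z => by simp [hL, dotProduct_single],
    ← Complex.exp_sum, Finset.sum_neg_distrib, ← Complex.ofReal_sum, Finset.sum_div]

/-- Since Re(a z) = a.re z.re - a.im z.im, the parts of a_i are L(e_i) and -L(i e_i). -/
lemma exists_dual_eq_re_dotProduct (L : StrongDual ℝ (ι → ℂ)) :
    ∃ a : ι → ℂ, ∀ v, L v = (a ⬝ᵥ v).re := by
  refine ⟨fun i => ⟨L (Pi.single i 1), -L (Pi.single i Complex.I)⟩, fun v => ?_⟩
  have h : v = ∑ i, ((v i).re • (Pi.single i 1 : ι → ℂ) +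
      (v i).im • (Pi.single i Complex.I : ι → ℂ)) := by
    ext j
    simp [Finset.sum_apply, Pi.single_apply, Finset.sum_add_distrib]
  conv_lhs => rw [h]
  simp only [map_sum, map_add, map_smul, smul_eq_mul, dotProduct, Complex.re_sum, Complex.mul_re]
  exact Finset.sum_congr rfl fun i _ => by ring

/-- `CN(0, I)` is invariant under unitary maps. -/
lemma map_mulVec_stdComplexGaussianVec {U : Matrix ι ι ℂ} (hU : U * Uᴴ = 1) :
    (stdComplexGaussianVec ι).map (fun v => U *ᵥ v) = stdComplexGaussianVec ι := by
  set T : (ι → ℂ) →L[ℝ] (ι → ℂ) :=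
    ((Matrix.mulVecLin U).restrictScalars ℝ).toContinuousLinearMap with hT
  have hT' : (fun v => U *ᵥ v) = T := by ext v; simp [hT]
  have : IsProbabilityMeasure ((stdComplexGaussianVec ι).map (fun v => U *ᵥ v)) :=
    Measure.isProbabilityMeasure_map (by rw [hT']; exact T.continuous.aemeasurable)
  -- The characteristic function at a depends only on ∑ |a_i|², which a ↦ a U preserves.
  refine Measure.ext_of_charFunDual ?_
  ext L
  obtain ⟨a, ha⟩ := exists_dual_eq_re_dotProduct L
  rw [hT', charFunDual_map, charFunDual_stdComplexGaussianVec L a ha,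
    charFunDual_stdComplexGaussianVec _ (a ᵥ* U) fun v => by
      simp [ha, hT, dotProduct_mulVec]]
  congr 4
  have h : ((∑ i, ‖(a ᵥ* U) i‖ ^ 2 : ℝ) : ℂ) = ((∑ i, ‖a i‖ ^ 2 : ℝ) : ℂ) := by
    rw [sum_norm_sq_eq_dotProduct, sum_norm_sq_eq_dotProduct, dotProduct_comm, star_vecMul,
      ← dotProduct_mulVec, mulVec_mulVec, hU, one_mulVec, dotProduct_comm]
  exact_mod_cast h

/-! ### Diagonalisation and Hermitian forms in Gaussian vectors -/

lemma Matrix.IsHermitian.eq_mul_diagonal_mul {C : Matrix ι ι ℂ} (hC : C.IsHermitian) :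
    C = (hC.eigenvectorUnitary : Matrix ι ι ℂ) * diagonal (fun i => (hC.eigenvalues i : ℂ)) *
      (hC.eigenvectorUnitary : Matrix ι ι ℂ)ᴴ := by
  conv_lhs => rw [hC.spectral_theorem, Unitary.conjStarAlgAut_apply]
  rfl

lemma Matrix.IsHermitian.eigenvectorUnitary_mul_conjTranspose {C : Matrix ι ι ℂ}
    (hC : C.IsHermitian) :
    (hC.eigenvectorUnitary : Matrix ι ι ℂ) * (hC.eigenvectorUnitary : Matrix ι ι ℂ)ᴴ = 1 :=
  Unitary.mul_star_self_of_mem hC.eigenvectorUnitary.2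

lemma Matrix.IsHermitian.eigenvectorUnitary_conjTranspose_mul {C : Matrix ι ι ℂ}
    (hC : C.IsHermitian) :
    (hC.eigenvectorUnitary : Matrix ι ι ℂ)ᴴ * (hC.eigenvectorUnitary : Matrix ι ι ℂ) = 1 :=
  Unitary.star_mul_self_of_mem hC.eigenvectorUnitary.2

lemma Matrix.IsHermitian.star_dotProduct_mulVec_eq {C : Matrix ι ι ℂ} (hC : C.IsHermitian)
    (v : ι → ℂ) : star v ⬝ᵥ (C *ᵥ v) = ((∑ i, hC.eigenvalues i *
      ‖((hC.eigenvectorUnitary : Matrix ι ι ℂ)ᴴ *ᵥ v) i‖ ^ 2 : ℝ) : ℂ) := by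
  set U := (hC.eigenvectorUnitary : Matrix ι ι ℂ) with hU
  conv_lhs => rw [hC.eq_mul_diagonal_mul, ← hU]
  rw [← mulVec_mulVec, ← mulVec_mulVec, dotProduct_mulVec,
    show star v ᵥ* U = star (Uᴴ *ᵥ v) by rw [star_mulVec, conjTranspose_conjTranspose]]
  simp only [dotProduct, mulVec_diagonal, Pi.star_apply, Complex.star_def]
  push_cast
  refine Finset.sum_congr rfl fun i _ => ?_
  rw [← Complex.conj_mul']
  ring

/-- The Laplace transform of a Hermitian form in a `CN(0, I)` vector. -/
lemma integral_exp_neg_mul_hermitian {C : Matrix ι ι ℂ} (hC : C.PosSemidef) {t : ℝ}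
    (ht : 0 ≤ t) :
    ∫ v, Real.exp (-(t * (star v ⬝ᵥ (C *ᵥ v)).re)) ∂(stdComplexGaussianVec ι) =
      ∏ i, (1 + t * hC.isHermitian.eigenvalues i)⁻¹ := by
  set d := hC.isHermitian.eigenvalues with hd
  set U := (hC.isHermitian.eigenvectorUnitary : Matrix ι ι ℂ) with hU
  have hUU : Uᴴ * Uᴴᴴ = 1 := by
    rw [conjTranspose_conjTranspose]
    exact hC.isHermitian.eigenvectorUnitary_conjTranspose_mul
  have hF : Measurable fun v : ι → ℂ => ∏ i, Real.exp (-(t * d i * ‖v i‖ ^ 2)) := by fun_prop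
  calc ∫ v, Real.exp (-(t * (star v ⬝ᵥ (C *ᵥ v)).re)) ∂(stdComplexGaussianVec ι)
      = ∫ v, ∏ i, Real.exp (-(t * d i * ‖(Uᴴ *ᵥ v) i‖ ^ 2)) ∂(stdComplexGaussianVec ι) := by
        congr with v
        rw [hC.isHermitian.star_dotProduct_mulVec_eq, Complex.ofReal_re, ← Real.exp_sum,
          Finset.mul_sum, ← Finset.sum_neg_distrib]
        simp_rw [← hd, ← hU, mul_assoc]
    _ = ∫ v, ∏ i, Real.exp (-(t * d i * ‖v i‖ ^ 2)) ∂(stdComplexGaussianVec ι) := by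
        conv_rhs => rw [← map_mulVec_stdComplexGaussianVec hUU]
        rw [integral_map (Continuous.aemeasurable (by fun_prop)) hF.aestronglyMeasurable]
    _ = _ := by
        rw [stdComplexGaussianVec, integral_fintype_prod_eq_prod
          (fun i (z : ℂ) => Real.exp (-(t * d i * ‖z‖ ^ 2)))]
        exact Finset.prod_congr rfl fun i _ =>
          integral_exp_neg_mul_norm_sq_stdComplexGaussian
            (mul_nonneg ht (hC.eigenvalues_nonneg i))

lemma Matrix.IsHermitian.prod_one_add_mul_eigenvalues {C : Matrix ι ι ℂ} (hC : C.IsHermitian)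
    (t : ℝ) : ((∏ i, (1 + t * hC.eigenvalues i) : ℝ) : ℂ) = (1 + (t : ℂ) • C).det := by
  set U := (hC.eigenvectorUnitary : Matrix ι ι ℂ) with hU
  have hUU : U * Uᴴ = 1 := hC.eigenvectorUnitary_mul_conjTranspose
  have h : (1 + (t : ℂ) • C) =
      U * diagonal (fun i => ((1 + t * hC.eigenvalues i : ℝ) : ℂ)) * Uᴴ := by
    have hD : diagonal (fun i => ((1 + t * hC.eigenvalues i : ℝ) : ℂ)) =
        1 + (t : ℂ) • diagonal (fun i => (hC.eigenvalues i : ℂ)) := by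
      rw [← diagonal_one, ← diagonal_smul, diagonal_add]
      congr with i
      simp
    rw [hD, mul_add, add_mul, mul_one, hUU, mul_smul_comm, smul_mul_assoc,
      ← hC.eq_mul_diagonal_mul]
  rw [h, det_mul_right_comm, hUU, one_mul, det_diagonal, Complex.ofReal_prod]

/-- |wᴴ v|² is the Hermitian form of the rank-one matrix w wᴴ. The determinant det(1 + t w wᴴ) = 1 +
t‖w‖² replaces a computation of its eigenvalues. -/
lemma integral_exp_neg_mul_norm_dotProduct_sq (w : ι → ℂ) {t : ℝ} (ht : 0 ≤ t) :
    ∫ v, Real.exp (-(t * ‖star w ⬝ᵥ v‖ ^ 2)) ∂(stdComplexGaussianVec ι) =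
      (1 + t * ∑ i, ‖w i‖ ^ 2)⁻¹ := by
  have hC : (vecMulVec w (star w)).PosSemidef := posSemidef_vecMulVec_self_star w
  have h1 : ∀ v, (star v ⬝ᵥ (vecMulVec w (star w) *ᵥ v)).re = ‖star w ⬝ᵥ v‖ ^ 2 := fun v => by
    rw [vecMulVec_mulVec, dotProduct_smul, op_smul_eq_mul, star_dotProduct, Complex.star_def,
      Complex.conj_mul']
    norm_cast
  simp_rw [← h1]
  rw [integral_exp_neg_mul_hermitian hC ht, Finset.prod_inv_distrib]
  congr 1
  have h2 := hC.isHermitian.prod_one_add_mul_eigenvalues t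
  have h3 : (1 + (t : ℂ) • vecMulVec w (star w)).det = ((1 + t * ∑ i, ‖w i‖ ^ 2 : ℝ) : ℂ) := by
    rw [← vecMulVec_smul, vecMulVec_eq Unit, det_one_add_replicateCol_mul_replicateRow,
      smul_dotProduct, ← sum_norm_sq_eq_dotProduct, smul_eq_mul]
    push_cast
    rfl
  exact_mod_cast h2.trans h3

end Vector

/-! ### The channel gain -/

section Channel

variable {ι : Type*} [Fintype ι] [DecidableEq ι]

lemma channelGain_eq (R : Matrix ι ι ℂ) (θ : ι → ℝ) (u f : ι → ℂ) :
    channelGain R θ u f = ‖star ((couplingMatrix R θ)ᴴ *ᵥ u) ⬝ᵥ f‖ ^ 2 := by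
  rw [channelGain, dotProduct_mulVec, star_mulVec, conjTranspose_conjTranspose]

lemma measurable_channelGain (R : Matrix ι ι ℂ) (θ : ι → ℝ) :
    Measurable fun p : (ι → ℂ) × (ι → ℂ) => channelGain R θ p.1 p.2 := by
  refine Continuous.measurable ?_
  unfold channelGain
  fun_prop

lemma posSemidef_compositeMatrix (R : Matrix ι ι ℂ) (θ : ι → ℝ) :
    (compositeMatrix R θ).PosSemidef :=
  posSemidef_self_mul_conjTranspose _

lemma sum_norm_sq_conjTranspose_couplingMatrix (R : Matrix ι ι ℂ) (θ : ι → ℝ) (u : ι → ℂ) :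
    ∑ i, ‖((couplingMatrix R θ)ᴴ *ᵥ u) i‖ ^ 2 = (star u ⬝ᵥ (compositeMatrix R θ *ᵥ u)).re := by
  rw [← Complex.ofReal_re (∑ i, _), sum_norm_sq_eq_dotProduct, star_mulVec,
    conjTranspose_conjTranspose, ← dotProduct_mulVec, mulVec_mulVec, compositeMatrix]

instance : IsProbabilityMeasure (gammaMeasure 1 1) :=
  isProbabilityMeasure_gammaMeasure one_pos one_pos

/-- The Laplace transform of the channel gain. -/
lemma integral_exp_neg_mul_channelGain (R : Matrix ι ι ℂ) (θ : ι → ℝ) {t : ℝ} (ht : 0 ≤ t) :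
    ∫ p : (ι → ℂ) × (ι → ℂ), Real.exp (-(t * channelGain R θ p.1 p.2))
      ∂((stdComplexGaussianVec ι).prod (stdComplexGaussianVec ι)) =
    ∫ e, ∏ i, (1 + t * e * (posSemidef_compositeMatrix R θ).isHermitian.eigenvalues i)⁻¹
      ∂(gammaMeasure 1 1) := by
  have hC := posSemidef_compositeMatrix R θ
  set Q : (ι → ℂ) → ℝ := fun u => (star u ⬝ᵥ (compositeMatrix R θ *ᵥ u)).re with hQ
  have hQm : Measurable Q := Continuous.measurable (by fun_prop)
  have hQ0 : ∀ u, 0 ≤ Q u := fun u => by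
    simp only [hQ]
    rw [← sum_norm_sq_conjTranspose_couplingMatrix]
    positivity
  have hG := measurable_channelGain R θ
  have hG0 : ∀ u f, 0 ≤ channelGain R θ u f := fun u f => by
    unfold channelGain
    positivity
  rw [integral_prod _ (Integrable.of_bound (C := 1)
    (Measurable.aestronglyMeasurable (by fun_prop)) (Filter.Eventually.of_forall fun p => by
      rw [Real.norm_of_nonneg (Real.exp_pos _).le, Real.exp_le_one_iff]
      have := mul_nonneg ht (hG0 p.1 p.2)
      linarith))]
  -- For fixed u the inner integral is 1/(1 + t Q(u)), the Laplace transform of an exponential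
  -- variable e. Introducing e makes the exponent linear in Q, so after a swap u can be integrated
  -- out.
  calc ∫ u, ∫ f, Real.exp (-(t * channelGain R θ u f)) ∂(stdComplexGaussianVec ι)
        ∂(stdComplexGaussianVec ι)
      = ∫ u, ∫ e, Real.exp (-(t * Q u * e)) ∂(gammaMeasure 1 1) ∂(stdComplexGaussianVec ι) := by
        congr with u
        simp_rw [channelGain_eq]
        rw [integral_exp_neg_mul_norm_dotProduct_sq _ ht,
          sum_norm_sq_conjTranspose_couplingMatrix]
        have := integral_exp_neg_mul_gammaMeasure le_rfl (mul_nonneg ht (hQ0 u))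
        rw [Nat.cast_one, pow_one] at this
        exact this.symm
    _ = ∫ e, ∫ u, Real.exp (-(t * Q u * e)) ∂(stdComplexGaussianVec ι) ∂(gammaMeasure 1 1) := by
        refine integral_integral_swap (Integrable.of_bound (C := 1)
          (Measurable.aestronglyMeasurable ?_) ?_)
        · unfold Function.uncurry
          fun_prop
        · filter_upwards [Measure.quasiMeasurePreserving_snd.ae (ae_pos_gammaMeasure 1)] with p hp
          rw [Function.uncurry, Real.norm_of_nonneg (Real.exp_pos _).le, Real.exp_le_one_iff]
          have := mul_nonneg (mul_nonneg ht (hQ0 p.1)) hp.le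
          linarith
    _ = _ := by
        refine integral_congr_ae ?_
        filter_upwards [ae_pos_gammaMeasure 1] with e he
        rw [← integral_exp_neg_mul_hermitian hC (mul_nonneg ht he.le)]
        congr with u
        rw [mul_right_comm]

/-! ### The positive spectrum -/

/-- Rank-nullity for C - μ, which is unitarily similar to a diagonal matrix whose rank counts the
eigenvalues other than μ. -/
lemma Matrix.IsHermitian.finrank_eigenspace_toLin' {C : Matrix ι ι ℂ} (hC : C.IsHermitian)
    (μ : ℝ) : Module.finrank ℂ (Module.End.eigenspace (Matrix.toLin' C) (μ : ℂ)) =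
      (Finset.univ.filter fun i => hC.eigenvalues i = μ).card := by
  set U := (hC.eigenvectorUnitary : Matrix ι ι ℂ) with hU
  have hUU : U * Uᴴ = 1 := hC.eigenvectorUnitary_mul_conjTranspose
  have h1 : C - (μ : ℂ) • 1 =
      U * diagonal (fun i => ((hC.eigenvalues i - μ : ℝ) : ℂ)) * Uᴴ := by
    have hD : diagonal (fun i => ((hC.eigenvalues i - μ : ℝ) : ℂ)) =
        diagonal (fun i => (hC.eigenvalues i : ℂ)) - (μ : ℂ) • 1 := by
      rw [← diagonal_one, ← diagonal_smul, diagonal_sub]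
      congr with i
      simp
    rw [hD, mul_sub, sub_mul, mul_smul_comm, smul_mul_assoc, mul_one, hUU,
      ← hC.eq_mul_diagonal_mul]
  have hrank : (C - (μ : ℂ) • 1).rank = Fintype.card {i // hC.eigenvalues i ≠ μ} := by
    have hdet : IsUnit U.det := by
      refine IsUnit.of_mul_eq_one Uᴴ.det ?_
      rw [← det_mul, hUU, det_one]
    have hdet' : IsUnit Uᴴ.det := by
      refine IsUnit.of_mul_eq_one U.det ?_
      rw [mul_comm, ← det_mul, hUU, det_one]
    rw [h1, rank_mul_eq_left_of_isUnit_det _ _ hdet', rank_mul_eq_right_of_isUnit_det _ _ hdet,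
      rank_diagonal]
    refine Fintype.card_congr (Equiv.subtypeEquivRight fun i => ?_)
    rw [Complex.ofReal_ne_zero, sub_ne_zero]
  have hker : Module.End.eigenspace (Matrix.toLin' C) (μ : ℂ) =
      LinearMap.ker (C - (μ : ℂ) • 1).mulVecLin := by
    ext v
    rw [Module.End.mem_eigenspace_iff, LinearMap.mem_ker, Matrix.toLin'_apply,
      Matrix.mulVecLin_apply, sub_mulVec, smul_mulVec, one_mulVec, sub_eq_zero]
  have hsum := LinearMap.finrank_range_add_finrank_ker (C - (μ : ℂ) • 1).mulVecLin
  rw [← Matrix.rank, hrank, Module.finrank_fintype_fun_eq_card] at hsum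
  rw [hker]
  have hcard := Finset.card_filter_add_card_filter_not (s := (Finset.univ : Finset ι))
    (fun i => hC.eigenvalues i = μ)
  rw [Fintype.card_subtype] at hsum
  rw [Finset.card_univ] at hcard
  simp only [ne_eq] at hsum
  omega

variable {C : Matrix ι ι ℂ} {q : ℕ} {lam : Fin q → ℝ} {m : Fin q → ℕ}

lemma IsPositiveSpectrum.pos (h : IsPositiveSpectrum C lam m) (i : Fin q) : 0 < lam i :=
  ((h.eigenvalue_iff (lam i)).2 ⟨i, rfl⟩).1

lemma IsPositiveSpectrum.multiplicity_pos (h : IsPositiveSpectrum C lam m) (i : Fin q) :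
    0 < m i := by
  rw [h.multiplicity i]
  have h2 := ((h.eigenvalue_iff (lam i)).2 ⟨i, rfl⟩).2
  rw [Module.End.hasEigenvalue_iff] at h2
  exact Nat.pos_of_ne_zero fun h0 => h2 (Submodule.finrank_eq_zero.1 h0)

/-- Zero eigenvalues contribute the factor 1, and each positive one equals exactly one `lam j`;
grouping by value yields the multiplicities. -/
lemma IsPositiveSpectrum.prod_eigenvalues (h : IsPositiveSpectrum C lam m) (hC : C.PosSemidef)
    (t : ℝ) : ∏ i, (1 + t * hC.isHermitian.eigenvalues i)⁻¹ =
      ∏ j, ((1 + lam j * t) ^ m j)⁻¹ := by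
  classical
  set d := hC.isHermitian.eigenvalues with hd
  have h1 : ∀ j, ((1 + lam j * t) ^ m j)⁻¹ =
      ∏ i, if d i = lam j then (1 + t * d i)⁻¹ else 1 := fun j => by
    rw [← Finset.prod_filter, Finset.prod_congr rfl (g := fun _ => (1 + lam j * t)⁻¹)
      fun i hi => by rw [(Finset.mem_filter.1 hi).2, mul_comm], Finset.prod_const, h.multiplicity j,
      hC.isHermitian.finrank_eigenspace_toLin', inv_pow]
  rw [Finset.prod_congr rfl fun j _ => h1 j, Finset.prod_comm]
  refine Finset.prod_congr rfl fun i _ => ?_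
  rcases (hC.eigenvalues_nonneg i).eq_or_lt with h0 | h0
  · have hi : d i = 0 := h0.symm
    rw [hi]
    simp
  · have hev : Module.End.HasEigenvalue (Matrix.toLin' C) (d i : ℂ) := by
      rw [Module.End.hasEigenvalue_iff]
      intro hbot
      have := hC.isHermitian.finrank_eigenspace_toLin' (d i)
      rw [hbot, finrank_bot, eq_comm, Finset.card_eq_zero] at this
      exact Finset.notMem_empty i (this ▸ Finset.mem_filter.2 ⟨Finset.mem_univ i, rfl⟩)
    obtain ⟨j, hj⟩ := (h.eigenvalue_iff (d i)).1 ⟨h0, hev⟩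
    rw [Finset.prod_eq_single j (fun j' _ hj' => if_neg fun h' => hj' (h.injective (by
      rw [← h', hj]))) (fun h' => absurd (Finset.mem_univ j) h'), if_pos hj.symm]

/-! ### The ergodic capacity -/

lemma integral_exp_neg_mul_gammaMeasure_prod {k : ℕ} (hk : 1 ≤ k) {t : ℝ} (ht : 0 ≤ t) :
    ∫ p : ℝ × ℝ, Real.exp (-(t * (p.1 * p.2))) ∂((gammaMeasure k 1).prod (gammaMeasure 1 1)) =
      ∫ e, ((1 + t * e) ^ k)⁻¹ ∂(gammaMeasure 1 1) := by
  have hk' : (0 : ℝ) < k := by exact_mod_cast hk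
  have : IsProbabilityMeasure (gammaMeasure k 1) := isProbabilityMeasure_gammaMeasure hk' one_pos
  rw [integral_prod_symm]
  · refine integral_congr_ae ?_
    filter_upwards [ae_pos_gammaMeasure 1] with e he
    rw [← integral_exp_neg_mul_gammaMeasure hk (mul_nonneg ht he.le)]
    congr with x
    ring_nf
  · refine Integrable.of_bound (C := 1) (Measurable.aestronglyMeasurable (by fun_prop)) ?_
    filter_upwards [Measure.quasiMeasurePreserving_fst.ae (ae_pos_gammaMeasure k),
      Measure.quasiMeasurePreserving_snd.ae (ae_pos_gammaMeasure 1)] with p hp1 hp2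
    rw [Real.norm_of_nonneg (Real.exp_pos _).le, Real.exp_le_one_iff]
    have := mul_nonneg ht (mul_nonneg hp1.le hp2.le)
    linarith

lemma integrable_inv_one_add_mul_pow_gammaMeasure {t : ℝ} (ht : 0 ≤ t) (k : ℕ) :
    Integrable (fun e => ((1 + t * e) ^ k)⁻¹) (gammaMeasure 1 1) := by
  refine Integrable.of_bound (C := 1) (Measurable.aestronglyMeasurable (by fun_prop)) ?_
  filter_upwards [ae_pos_gammaMeasure 1] with e he
  have h1 : 1 ≤ 1 + t * e := by nlinarith
  rw [Real.norm_of_nonneg (by positivity)]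
  exact inv_le_one_of_one_le₀ (one_le_pow₀ h1)

/-- At t = 0 the expansion says that the coefficients sum to 1. Subtracting from 1 also covers q = 0
(that is, C = 0), where the expansion itself fails but both sides here vanish. -/
lemma one_sub_prod_eq_sum_mixtureCoeff (hpos : ∀ i, 0 < lam i) (hinj : Function.Injective lam)
    (hm : ∀ i, 0 < m i) {t : ℝ} (ht : 0 ≤ t) :
    1 - ∏ i, ((1 + lam i * t) ^ m i)⁻¹ =
      ∑ i, ∑ k ∈ Finset.Icc 1 (m i), mixtureCoeff lam m i k * (1 - ((1 + lam i * t) ^ k)⁻¹) := by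
  rcases Nat.eq_zero_or_pos q with rfl | hq
  · simp
  · have hdeg : ∃ i, 0 < m i := ⟨⟨0, hq⟩, hm _⟩
    have h0 := sum_mixtureCoeff_mul_inv_pow hpos hinj hdeg le_rfl
    rw [← sum_mixtureCoeff_mul_inv_pow hpos hinj hdeg ht]
    simp only [mul_zero, add_zero, one_pow, inv_one, mul_one, Finset.prod_const_one] at h0
    simp_rw [mul_sub, mul_one, Finset.sum_sub_distrib]
    rw [h0]

lemma log_channelGain_expectation (R : Matrix ι ι ℂ) (θ : ι → ℝ) {κ : ℝ} (hκ : 0 < κ)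
    (h : IsPositiveSpectrum (compositeMatrix R θ) lam m) :
    Integrable (fun p : (ι → ℂ) × (ι → ℂ) => Real.log (1 + κ * channelGain R θ p.1 p.2))
      ((stdComplexGaussianVec ι).prod (stdComplexGaussianVec ι)) ∧
    ∫ p : (ι → ℂ) × (ι → ℂ), Real.log (1 + κ * channelGain R θ p.1 p.2)
      ∂((stdComplexGaussianVec ι).prod (stdComplexGaussianVec ι)) =
      ∑ i, ∑ k ∈ Finset.Icc 1 (m i), mixtureCoeff lam m i k *
        ∫ p : ℝ × ℝ, Real.log (1 + κ * lam i * (p.1 * p.2))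
          ∂((gammaMeasure k 1).prod (gammaMeasure 1 1)) := by
  have hC := posSemidef_compositeMatrix R θ
  have hG := measurable_channelGain R θ
  have hG0 : ∀ u f, 0 ≤ channelGain R θ u f := fun u f => by
    unfold channelGain
    positivity
  rw [Finset.sum_sigma']
  have hs : ∀ j ∈ Finset.univ.sigma fun i => Finset.Icc 1 (m i), 1 ≤ j.2 := fun j hj =>
    (Finset.mem_Icc.1 (Finset.mem_sigma.1 hj).2).1
  have hprob : ∀ j ∈ Finset.univ.sigma fun i => Finset.Icc 1 (m i),
      IsProbabilityMeasure ((gammaMeasure (j.2 : ℝ) 1).prod (gammaMeasure 1 1)) := fun j hj => by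
    have : IsProbabilityMeasure (gammaMeasure (j.2 : ℝ) 1) :=
      isProbabilityMeasure_gammaMeasure (by exact_mod_cast hs j hj) one_pos
    infer_instance
  refine integral_log_one_add_eq_sum ((stdComplexGaussianVec ι).prod (stdComplexGaussianVec ι))
    (hG.const_mul κ) (Filter.Eventually.of_forall fun p => mul_nonneg hκ.le (hG0 _ _))
    (Finset.univ.sigma fun i => Finset.Icc 1 (m i)) (fun j => mixtureCoeff lam m j.1 j.2)
    (fun j => (gammaMeasure (j.2 : ℝ) 1).prod (gammaMeasure 1 1)) hprob
    (fun j p => κ * lam j.1 * (p.1 * p.2)) (fun j => by fun_prop) (fun j hj => ?_)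
    (fun j hj => integrable_log_gammaMeasure_prod (hs j hj) (mul_nonneg hκ.le (h.pos j.1).le))
    fun y hy => ?_
  · have := hprob j hj
    filter_upwards [Measure.quasiMeasurePreserving_fst.ae (ae_pos_gammaMeasure j.2),
      Measure.quasiMeasurePreserving_snd.ae (ae_pos_gammaMeasure 1)] with p hp1 hp2
    have := h.pos j.1
    positivity
  · have hκy : 0 ≤ κ * y := by positivity
    have hterm : ∀ i, ∀ k, Integrable (fun e => ((1 + lam i * (κ * y * e)) ^ k)⁻¹)
        (gammaMeasure 1 1) := fun i k => by
      have := integrable_inv_one_add_mul_pow_gammaMeasure (mul_nonneg (h.pos i).le hκy) k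
      simpa only [mul_assoc] using this
    have hL : ∫ p : (ι → ℂ) × (ι → ℂ), Real.exp (-(κ * channelGain R θ p.1 p.2 * y))
        ∂((stdComplexGaussianVec ι).prod (stdComplexGaussianVec ι)) =
        ∫ e, ∏ i, ((1 + lam i * (κ * y * e)) ^ m i)⁻¹ ∂(gammaMeasure 1 1) := by
      simp_rw [mul_right_comm κ _ y]
      rw [integral_exp_neg_mul_channelGain R θ hκy]
      congr with e
      rw [h.prod_eigenvalues hC]
    have hprodInt : Integrable (fun e => ∏ i, ((1 + lam i * (κ * y * e)) ^ m i)⁻¹)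
        (gammaMeasure 1 1) := by
      refine Integrable.of_bound (C := 1) (Measurable.aestronglyMeasurable (by fun_prop)) ?_
      filter_upwards [ae_pos_gammaMeasure 1] with e he
      have h1 : ∀ i, 1 ≤ 1 + lam i * (κ * y * e) := fun i => by
        have := h.pos i
        have : 0 ≤ lam i * (κ * y * e) := by positivity
        linarith
      have h2 : ∀ i, 0 ≤ ((1 + lam i * (κ * y * e)) ^ m i)⁻¹ := fun i => by
        have := h1 i
        positivity
      rw [Real.norm_of_nonneg (Finset.prod_nonneg fun i _ => h2 i)]
      exact Finset.prod_le_one (fun i _ => h2 i)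
        fun i _ => inv_le_one_of_one_le₀ (one_le_pow₀ (h1 i))
    have hR : ∀ j ∈ Finset.univ.sigma fun i => Finset.Icc 1 (m i),
        mixtureCoeff lam m j.1 j.2 * (1 - ∫ p : ℝ × ℝ, Real.exp (-(κ * lam j.1 * (p.1 * p.2) * y))
          ∂((gammaMeasure (j.2 : ℝ) 1).prod (gammaMeasure 1 1))) =
        ∫ e, mixtureCoeff lam m j.1 j.2 * (1 - ((1 + lam j.1 * (κ * y * e)) ^ j.2)⁻¹)
          ∂(gammaMeasure 1 1) := fun j hj => by
      have h1 := integral_exp_neg_mul_gammaMeasure_prod (hs j hj)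
        (mul_nonneg hκy (h.pos j.1).le)
      rw [integral_const_mul, integral_sub (integrable_const _) (hterm _ _)]
      congr 2
      · simp
      · refine Eq.trans ?_ (h1.trans ?_)
        · congr with p
          ring_nf
        · congr with e
          ring_nf
    have hI : ∀ j ∈ Finset.univ.sigma fun i => Finset.Icc 1 (m i), Integrable (fun e =>
        mixtureCoeff lam m j.1 j.2 * (1 - ((1 + lam j.1 * (κ * y * e)) ^ j.2)⁻¹))
        (gammaMeasure 1 1) := fun j _ =>
      ((integrable_const _).sub (hterm _ _)).const_mul _
    rw [hL, Finset.sum_congr rfl hR, ← integral_finsetSum _ hI]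
    -- With 1 averaged over the exponential variable e as well, both sides become integrals in e and
    -- the partial fraction identity applies pointwise.
    have h1 : (1 : ℝ) = ∫ _ : ℝ, (1 : ℝ) ∂(gammaMeasure 1 1) := by simp
    conv_lhs => enter [1]; rw [h1]
    rw [← integral_sub (integrable_const _) hprodInt]
    refine integral_congr_ae ?_
    filter_upwards [ae_pos_gammaMeasure 1] with e he
    rw [one_sub_prod_eq_sum_mixtureCoeff h.pos h.injective h.multiplicity_pos
      (mul_nonneg hκy he.le), Finset.sum_sigma']

/-- Integrability of the capacity is claimed without reference to an enumeration of the spectrum, so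
one has to be produced. -/
lemma exists_isPositiveSpectrum (hC : C.PosSemidef) :
    ∃ (q : ℕ) (lam : Fin q → ℝ) (m : Fin q → ℕ), IsPositiveSpectrum C lam m := by
  classical
  set s : Finset ℝ := (Finset.univ.image hC.isHermitian.eigenvalues).filter fun x => 0 < x with hs
  refine ⟨s.card, fun i => s.equivFin.symm i, fun i => Module.finrank ℂ
    (Module.End.eigenspace (Matrix.toLin' C) ((s.equivFin.symm i : ℝ) : ℂ)),
    fun i j hij => s.equivFin.symm.injective (Subtype.ext hij), fun μ => ?_, fun i => rfl⟩
  have h1 : (0 < μ ∧ Module.End.HasEigenvalue (Matrix.toLin' C) (μ : ℂ)) ↔ μ ∈ s := by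
    rw [hs, Finset.mem_filter, and_comm, Finset.mem_image, Module.End.hasEigenvalue_iff, ne_eq,
      ← Submodule.finrank_eq_zero, hC.isHermitian.finrank_eigenspace_toLin', Finset.card_eq_zero,
      ← ne_eq, ← Finset.nonempty_iff_ne_empty]
    simp [Finset.Nonempty]
  rw [h1]
  exact ⟨fun h => ⟨s.equivFin ⟨μ, h⟩, by simp⟩, fun ⟨i, hi⟩ => hi ▸ (s.equivFin.symm i).2⟩

end Channel

/-! ### Transfer to the underlying probability space, and the case R = 1 -/

section Capacity

variable {ι : Type*} [Fintype ι] [DecidableEq ι] {Ω : Type*} [MeasurableSpace Ω] {P : Measure Ω}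
  [IsProbabilityMeasure P] {gu gf : Ω → ι → ℂ} {gbar Lf Lu : ℝ}

lemma integrable_instantCapacity (hgu : HasLaw gu (stdComplexGaussianVec ι) P)
    (hgf : HasLaw gf (stdComplexGaussianVec ι) P) (hindep : IndepFun gu gf P) (R : Matrix ι ι ℂ)
    (θ : ι → ℝ) (hκ : 0 < gbar * Lf * Lu) :
    Integrable (fun ω => instantCapacity R θ gbar Lf Lu (gu ω) (gf ω)) P := by
  obtain ⟨q, lam, m, h⟩ := exists_isPositiveSpectrum (posSemidef_compositeMatrix R θ)
  have hlaw := hindep.hasLaw_prod hgu hgf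
  have hi := (log_channelGain_expectation R θ hκ h).1
  rw [← hlaw.map_eq] at hi
  exact (hi.comp_aemeasurable hlaw.aemeasurable).div_const (Real.log 2)

lemma ergodicCapacity_eq_sum (hgu : HasLaw gu (stdComplexGaussianVec ι) P)
    (hgf : HasLaw gf (stdComplexGaussianVec ι) P) (hindep : IndepFun gu gf P) (R : Matrix ι ι ℂ)
    (θ : ι → ℝ) (hκ : 0 < gbar * Lf * Lu) {q : ℕ} {lam : Fin q → ℝ} {m : Fin q → ℕ}
    (h : IsPositiveSpectrum (compositeMatrix R θ) lam m) :
    (ergodicCapacity P R θ gbar Lf Lu gu gf : ℂ) =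
      (1 / (Real.log 2 : ℂ)) * ∑ i, ∑ k ∈ Finset.Icc 1 (m i),
        (mixtureCoeff lam m i k : ℂ) / Complex.Gamma k *
          meijerG 1 4 ![1 - (k : ℂ), 0, 1, 1] ![1, 0] ((gbar * Lf * Lu * lam i : ℝ) : ℂ) := by
  have hlaw := hindep.hasLaw_prod hgu hgf
  have hG := measurable_channelGain R θ
  have h1 : ergodicCapacity P R θ gbar Lf Lu gu gf = (1 / Real.log 2) *
      ∫ p : (ι → ℂ) × (ι → ℂ), Real.log (1 + gbar * Lf * Lu * channelGain R θ p.1 p.2)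
        ∂((stdComplexGaussianVec ι).prod (stdComplexGaussianVec ι)) := by
    rw [ergodicCapacity, ← hlaw.integral_comp (Measurable.aestronglyMeasurable (by fun_prop)),
      ← integral_const_mul]
    congr with ω
    rw [instantCapacity, Real.logb, Function.comp_apply]
    ring
  rw [h1, (log_channelGain_expectation R θ hκ h).2]
  push_cast
  congr 1
  refine Finset.sum_congr rfl fun i _ => Finset.sum_congr rfl fun k hk => ?_
  have hk1 : 1 ≤ k := (Finset.mem_Icc.1 hk).1
  have hx : 0 < gbar * Lf * Lu * lam i := mul_pos hκ (h.pos i)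
  have hΓ : Complex.Gamma k ≠ 0 := Complex.Gamma_ne_zero_of_re_pos (by
    rw [Complex.natCast_re]
    exact_mod_cast hk1)
  have hG := meijerG_capacity hk1 hx
  push_cast at hG
  rw [hG]
  field_simp

lemma isPositiveSpectrum_compositeMatrix_one [Nonempty ι] (θ : ι → ℝ) :
    IsPositiveSpectrum (compositeMatrix (1 : Matrix ι ι ℂ) θ) ![1] ![Fintype.card ι] := by
  have hC : compositeMatrix (1 : Matrix ι ι ℂ) θ = 1 := by
    -- For R = 1 the coupling matrix is Φ itself, which is unitary because its phases have modulus
    -- 1.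
    rw [compositeMatrix, couplingMatrix, CFC.sqrt_one, one_mul, mul_one, reflectionMatrix,
      diagonal_conjTranspose, diagonal_mul_diagonal, ← diagonal_one]
    congr with i
    rw [Pi.star_apply, Complex.star_def, Complex.mul_conj', mul_comm, Complex.norm_exp_ofReal_mul_I]
    simp
  rw [hC]
  have heig : ∀ μ : ℂ, Module.End.eigenspace (Matrix.toLin' (1 : Matrix ι ι ℂ)) μ =
      if μ = 1 then ⊤ else ⊥ := fun μ => by
    ext v
    rw [Module.End.mem_eigenspace_iff, Matrix.toLin'_one, LinearMap.id_apply]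
    split_ifs with h
    · simp [h]
    · rw [Submodule.mem_bot]
      constructor
      · intro hv
        have : (1 - μ) • v = 0 := by rw [sub_smul, one_smul, ← hv, sub_self]
        exact (smul_eq_zero.1 this).resolve_left (sub_ne_zero.2 (Ne.symm h))
      · rintro rfl
        simp
  refine ⟨Function.injective_of_subsingleton _, fun μ => ?_, fun i => ?_⟩
  · rw [Module.End.hasEigenvalue_iff, heig]
    constructor
    · rintro ⟨_, h⟩
      refine ⟨0, ?_⟩
      by_contra hne
      refine h (if_neg fun h' => hne ?_)
      simpa using (Complex.ofReal_eq_one.1 h').symm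
    · rintro ⟨i, hi⟩
      have : μ = 1 := by rw [← hi, Subsingleton.elim i 0]; rfl
      subst this
      simp
  · rw [Subsingleton.elim i 0, heig, if_pos (by simp), finrank_top,
      Module.finrank_fintype_fun_eq_card]
    rfl

end Capacity

theorem mainTheorem6 {ι : Type*} [Fintype ι] [DecidableEq ι] [Nonempty ι]
    {Ω : Type*} [MeasurableSpace Ω] (P : Measure Ω) [IsProbabilityMeasure P]
    (gu gf : Ω → ι → ℂ)
    (hgu : HasLaw gu (stdComplexGaussianVec ι) P) (hgf : HasLaw gf (stdComplexGaussianVec ι) P)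
    (hindep : IndepFun gu gf P)
    (R : Matrix ι ι ℂ) (hR : R.PosSemidef) (θ : ι → ℝ)
    (Pt N₀ ρf df αf ρu du αu gbar Lf Lu : ℝ)
    (hPt : 0 < Pt) (hN₀ : 0 < N₀) (hρf : 0 < ρf) (hdf : 0 < df) (hρu : 0 < ρu) (hdu : 0 < du)
    (hgbar : gbar = Pt / N₀) (hLf : Lf = pathLoss ρf df αf) (hLu : Lu = pathLoss ρu du αu) :
    -- the expectation defining the ergodic capacity exists
    Integrable (fun ω => instantCapacity R θ gbar Lf Lu (gu ω) (gf ω)) P ∧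
    -- the Meijer G-values below are absolutely convergent Mellin-Barnes integrals
    (∀ k : ℕ, 1 ≤ k → ∀ x : ℝ, 0 < x →
      MeijerGWellDefined 1 4 ![1 - (k : ℂ), 0, 1, 1] ![1, 0] (x : ℂ)) ∧
    -- general multiplicities
    (∀ (q : ℕ) (lam : Fin q → ℝ) (m : Fin q → ℕ),
      IsPositiveSpectrum (compositeMatrix R θ) lam m →
      (ergodicCapacity P R θ gbar Lf Lu gu gf : ℂ) =
        (1 / (Real.log 2 : ℂ)) * ∑ i, ∑ k ∈ Finset.Icc 1 (m i),
          (mixtureCoeff lam m i k : ℂ) / Complex.Gamma k *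
            meijerG 1 4 ![1 - (k : ℂ), 0, 1, 1] ![1, 0] ((gbar * Lf * Lu * lam i : ℝ) : ℂ)) ∧
    -- simple eigenvalues
    (∀ (q : ℕ) (lam : Fin q → ℝ),
      IsPositiveSpectrum (compositeMatrix R θ) lam (fun _ => 1) →
      (∀ i, mixtureCoeff lam (fun _ => 1) i 1 =
        ∏ j ∈ Finset.univ.erase i, lam i / (lam i - lam j)) ∧
      (ergodicCapacity P R θ gbar Lf Lu gu gf : ℂ) =
        (1 / (Real.log 2 : ℂ)) * ∑ i, (mixtureCoeff lam (fun _ => 1) i 1 : ℂ) *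
          meijerG 1 4 ![0, 0, 1, 1] ![1, 0] ((gbar * Lf * Lu * lam i : ℝ) : ℂ)) ∧
    -- a single distinct positive eigenvalue
    (∀ (lam₁ : ℝ) (m₁ : ℕ), IsPositiveSpectrum (compositeMatrix R θ) ![lam₁] ![m₁] →
      (ergodicCapacity P R θ gbar Lf Lu gu gf : ℂ) =
        (1 / ((Real.log 2 : ℂ) * Complex.Gamma m₁)) *
          meijerG 1 4 ![1 - (m₁ : ℂ), 0, 1, 1] ![1, 0] ((gbar * Lf * Lu * lam₁ : ℝ) : ℂ)) ∧
    -- uncorrelated elements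
    (R = 1 →
      (ergodicCapacity P R θ gbar Lf Lu gu gf : ℂ) =
        (1 / ((Real.log 2 : ℂ) * Complex.Gamma (Fintype.card ι))) *
          meijerG 1 4 ![1 - (Fintype.card ι : ℂ), 0, 1, 1] ![1, 0]
            ((gbar * Lf * Lu : ℝ) : ℂ)) ∧
    -- the Clarke-Jakes matrix of any active set is an admissible correlation matrix `R`
    (∀ (Mx Mz : ℕ) (dw lc : ℝ), 0 < dw → 0 < lc → ∀ S : Finset (Fin Mx × Fin Mz),
      (jakesCorrelation dw lc S).PosSemidef) := by
  have hκ : 0 < gbar * Lf * Lu := by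
    subst hgbar hLf hLu
    unfold pathLoss
    positivity
  have hgen := fun (q : ℕ) (lam : Fin q → ℝ) (m : Fin q → ℕ)
    (h : IsPositiveSpectrum (compositeMatrix R θ) lam m) =>
      ergodicCapacity_eq_sum hgu hgf hindep R θ hκ h
  have hsingle : ∀ (lam₁ : ℝ) (m₁ : ℕ),
      IsPositiveSpectrum (compositeMatrix R θ) ![lam₁] ![m₁] →
      (ergodicCapacity P R θ gbar Lf Lu gu gf : ℂ) =
        (1 / ((Real.log 2 : ℂ) * Complex.Gamma m₁)) *
          meijerG 1 4 ![1 - (m₁ : ℂ), 0, 1, 1] ![1, 0] ((gbar * Lf * Lu * lam₁ : ℝ) : ℂ) := by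
    intro lam₁ m₁ h
    have hm : 1 ≤ m₁ := h.multiplicity_pos 0
    rw [hgen 1 _ _ h, Fin.sum_univ_one]
    simp only [Matrix.cons_val_zero]
    -- Only the pole of full order carries a nonzero coefficient.
    rw [Finset.sum_eq_single m₁]
    · rw [mixtureCoeff_single lam₁ m₁ le_rfl, if_pos rfl, Complex.ofReal_one, ← mul_assoc,
        one_div_mul_one_div]
    · intro k hk hne
      rw [mixtureCoeff_single lam₁ m₁ (Finset.mem_Icc.1 hk).2, if_neg hne]
      simp
    · intro h'
      exact absurd (Finset.mem_Icc.2 ⟨hm, le_rfl⟩) h'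
  refine ⟨integrable_instantCapacity hgu hgf hindep R θ hκ,
    fun k hk x hx => meijerGWellDefined_capacity hk hx, hgen, fun q lam h => ⟨fun i =>
      mixtureCoeff_simple h.pos i, ?_⟩, hsingle, ?_, fun Mx Mz dw lc _ _ S =>
        jakesCorrelation_posSemidef dw lc S⟩
  · rw [hgen q lam _ h]
    simp
  · rintro rfl
    have h := hsingle 1 (Fintype.card ι) (isPositiveSpectrum_compositeMatrix_one θ)
    rwa [mul_one] at h
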